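/- **Setting.** Let $\kappa>0$, $1\le k\le n$, and let $x_1,\dots,x_n\in\mathbb R^d$ be i.i.d. $\kappa$-subgaussian feature vectors, i.e. $\mathbb E\exp(\langle u,x_i\rangle^2/\kappa^2)\le 2$ for every unit vector $u$. Let $\Sigma=\mathbb E[x_ix_i^{\top}]$ (the covariance matrix, for centered features), and let $X\in\mathbb R^{n\times d}$ have rows $x_i^\top$. Responses follow $y=X\theta^*+\xi$, where $\mathbb E[\xi]=0$, $\mathbb E[\xi\xi^\top]=\sigma^2 I_n$. Let $\mathcal G$ be a $\sigma$-algebra that contains $\sigma(X)$ (and possibly side information used to form bags) and is independent of $\xi$; the basic case is $\mathcal G=\sigma(X)$. A *bagging* $B$ is a partition of $[n]$ into nonempty bags $B_1,\dots,B_m$, for any $m$. Its matrix $S\in\mathbb R^{m\times n}$ has entries $S_{\ell i}=|B_\ell|^{-1/2}$ if $i\in B_\ell$ and $0$ otherwise. For a prior $\tilde y\in\mathbb R^n$ (predicted responses), a bagging is *optimal for $\tilde y$* if it minimizes $\sum_\ell\sum_{i\in B_\ell}\bigl(\tilde y_i-\tfrac1{|B_\ell|}\sum_{j\in B_\ell}\tilde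 y_j\bigr)^2$ among all baggings whose bags all have size at least $k$. The estimator built from a bagging is a minimizer $\hat\theta$ of the event-level loss $\frac1n\sum_\ell\sum_{i\in B_\ell}(\bar y_\ell-\langle x_i,\theta\rangle)^2$, where $\bar y_\ell$ is the mean response in $B_\ell$. **Theorem.** There are constants $C,c>0$ depending only on $\kappa$ such that the following holds whenever $\sigma_{\min}(\Sigma)>C\sqrt{d/n}$. There is an event $\mathcal E\in\sigma(X)$ with $$\Pr(\mathcal E)\ge 1-\tfrac1n-2e^{-cd}$$ such that for every (random) bagging $S$ that is almost surely optimal for the true prior $X\theta^*$: 1. (Optimal bags.) If $S$ is $\mathcal G$-measurable with $m$ bags, then, almost surely on $\mathcal E$, the estimator built from $S$ satisfies $$\mathbb E\bigl[\|\hat\theta-\theta^*\|^2\,\big|\,\mathcal G\bigr]\le\frac{8k\kappa^2\|\theta^*\|^2\log n+\sigma^2\min(m,d)}{n\sigma_{\min}(\Sigma)-C\sqrt{dn}}.$$ 2. (Approximate prior.) Let $\tilde S$ be a $\mathcal G$-measurable bagging, with $\tilde m$ bags, that is almost surely optimal for an arbitrary (random) prior $\tilde y$, and suppose that $\|S^\top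 S-\tilde S^\top\tilde S\|_{\mathrm{op}}\le\varepsilon$ almost surely. Then, for every $\eta>0$, almost surely on the same event $\mathcal E$, the estimator built from $\tilde S$ satisfies $$\mathbb E\bigl[\|\hat\theta-\theta^*\|^2\,\big|\,\mathcal G\bigr]\le\frac{(1+\frac1\eta)\,8k\kappa^2\|\theta^*\|^2\log n+\sigma^2\min(\tilde m,d)}{n\sigma_{\min}(\Sigma)-C\sqrt{dn}}+(1+\eta)\,\varepsilon^2\|\theta^*\|^2\,\frac{\sigma_{\max}(\Sigma)+C\sqrt{d/n}}{\sigma_{\min}(\Sigma)-C\sqrt{d/n}}.$$ In particular ($\eta=1$), both the first term of the bias and the inflation term carry a factor $2$. -/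

import Mathlib

open MeasureTheory ProbabilityTheory

namespace AggregateLearning

noncomputable section

/-- The random vector `x` is `κ`-subgaussian: every one-dimensional marginal `⟨u, x⟩` with `‖u‖ = 1`
satisfies `𝔼 exp(⟨u, x⟩² / κ²) ≤ 2`. -/
def IsSubgaussianVector {Ω : Type*} [MeasurableSpace Ω] {d : ℕ}
    (x : Ω → EuclideanSpace ℝ (Fin d)) (κ : ℝ) (P : Measure Ω) : Prop :=
  ∀ u : EuclideanSpace ℝ (Fin d), ‖u‖ = 1 →
    ∫⁻ ω, ENNReal.ofReal (Real.exp ((inner ℝ u (x ω)) ^ 2 / κ ^ 2)) ∂P ≤ 2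

/-- A bagging configuration: a partition of the `n` samples into nonempty, pairwise disjoint bags
(any number of them). -/
abbrev Bagging (n : ℕ) : Type := Finpartition (Finset.univ : Finset (Fin n))

/-- The number of bags. -/
def numBags {n : ℕ} (B : Bagging n) : ℕ := B.parts.card

/-- Every bag has size at least `k`. -/
def MinSize {n : ℕ} (k : ℕ) (B : Bagging n) : Prop := ∀ b ∈ B.parts, k ≤ b.card

/-- The mean of the numbers `y i` over the bag `b`. -/
def bagMean {n : ℕ} (y : Fin n → ℝ) (b : Finset (Fin n)) : ℝ := (∑ i ∈ b, y i) / (b.card : ℝ)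

/-- The bagging matrix `S`, with one row per bag: `S b i = 1 / √|b|` if `i ∈ b`, and `0` otherwise. -/
def bagMatrix {n : ℕ} (B : Bagging n) : Matrix {b // b ∈ B.parts} (Fin n) ℝ :=
  fun b i => if i ∈ b.1 then 1 / √(b.1.card : ℝ) else 0

/-- The one-dimensional `k`-means objective of the bags `B` at the points `y i`. -/
def kMeansCost {n : ℕ} (y : Fin n → ℝ) (B : Bagging n) : ℝ :=
  ∑ b ∈ B.parts, ∑ i ∈ b, (y i - bagMean y b) ^ 2

/-- `B` solves one-dimensional size-constrained `k`-means clustering for the predicted responses `y`: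
it minimizes the objective among all partitions into bags of size at least `k`. -/
def IsOptimalBagging {n : ℕ} (k : ℕ) (y : Fin n → ℝ) (B : Bagging n) : Prop :=
  MinSize k B ∧ ∀ B' : Bagging n, MinSize k B' → kMeansCost y B ≤ kMeansCost y B'

/-- The event-level squared loss of the linear model `t`: each individual prediction `⟨x i, t⟩` is
fitted to the mean response of the bag of `i`. -/
def eventLoss {n d : ℕ} (x : Fin n → EuclideanSpace ℝ (Fin d)) (y : Fin n → ℝ) (B : Bagging n)
    (t : EuclideanSpace ℝ (Fin d)) : ℝ :=
  (1 / (n : ℝ)) * ∑ b ∈ B.parts, ∑ i ∈ b, (bagMean y b - inner ℝ (x i) t) ^ 2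

/-- The vector of the values `⟨x i, t⟩`, that is, `X t` for the matrix `X` with rows `x i`. -/
def linPred {n d : ℕ} (x : Fin n → EuclideanSpace ℝ (Fin d)) (t : EuclideanSpace ℝ (Fin d)) :
    Fin n → ℝ := fun i => inner ℝ (x i) t

/-- The `ℓ²`-operator norm of a square real matrix. -/
def opNorm {n : ℕ} (A : Matrix (Fin n) (Fin n) ℝ) : ℝ := ‖Matrix.toEuclideanCLM (𝕜 := ℝ) A‖

/-- The largest singular value of a square matrix (Mathlib lists the singular values in decreasing
order, starting from index `0`). -/
def sigmaMax {d : ℕ} (A : Matrix (Fin d) (Fin d) ℝ) : ℝ :=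
  (Matrix.toEuclideanLin A).singularValues 0

/-- The smallest singular value of a square matrix of size `d ≥ 1`. -/
def sigmaMin {d : ℕ} (A : Matrix (Fin d) (Fin d) ℝ) : ℝ :=
  (Matrix.toEuclideanLin A).singularValues (d - 1)

end

end AggregateLearning

/-!
Write `X` for the design matrix, `S` for the bagging matrix and `L = (Xᵀ X)⁻¹ Xᵀ`. The product
`Sᵀ S` is the orthogonal projection that replaces every entry of a vector by its bag mean
(`bagAverage`), so the event-level loss is `1 / n` times the squared distance from `X t` to
`Sᵀ S y`, and its minimizer has the error

  `θhat - θ = L (Sᵀ S - 1) X θ + L Sᵀ S ξ`   (`minimizer_sub_eq_estimationError`).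

The bags and the features are known given `𝒢` and the noise is independent of `𝒢`, so that the
conditional risk is the squared norm of the first term plus `σ²` times the squared Frobenius norm of
`L Sᵀ S`. If `Xᵀ X ≥ lam`, then `L` and its adjoint have norm at most `lam ^ (-1/2)`. Hence the bias
is at most `‖(Sᵀ S - 1) X θ‖² / lam`, which is the `k`-means cost of the bags at `X θ` divided by
`lam`. The Frobenius norm can be computed over the `d` rows of `L` or over the `m` normalized bag
indicators, and each of these contributes at most `1 / lam`
(`sum_bagAverage_leastSquares_sq_le`). Together this is `condLExp_sq_norm_sub_le`.

The cost of optimal bags is bounded by that of the bags which cut the sorted values into runs of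
`k`: when all values lie in `[-R, R]`, it is at most `2 k R²` (`IsOptimalBagging.kMeansCost_le`). By
the subgaussian tail bound and a union bound, `R = 2 κ ‖θ‖ √(log n)` is admissible with probability
at least `1 - 1 / n`. For bags that are optimal for another prior, `kMeansCost_le_of_opNorm_le`
compares the two projections.

The value of `lam`, and the upper bound on `Xᵀ X` in the inflation term, come from the concentration
of `n⁻¹ Xᵀ X` around the second moment matrix at scale `κ² √(d / n)`, outside an event of
probability `2 exp (-d)` (`measure_lt_norm_gramDeviation_le`): a Bernstein inequality for the
bilinear form at pairs of points of a `1/2`-net of the sphere, and a union bound. The net is a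
maximal separated set, whose cardinality is bounded by comparing volumes.
-/

namespace AggregateLearning

/-! ### Bags of consecutive values -/

/-- Among the points of `s`, some `k` of them carry the smallest values of `z`. -/
lemma exists_subset_card_eq_forall_le {ι : Type*} [DecidableEq ι] (z : ι → ℝ) (s : Finset ι)
    (k : ℕ) (hk : k ≤ s.card) :
    ∃ b ⊆ s, b.card = k ∧ ∀ i ∈ b, ∀ j ∈ s \ b, z i ≤ z j := by
  induction k with
  | zero => exact ⟨∅, by simp, by simp, by simp⟩
  | succ k ih =>
    obtain ⟨b, hbs, hbk, hb⟩ := ih (by omega)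
    have hne : (s \ b).Nonempty := by
      rw [← Finset.card_pos, Finset.card_sdiff_of_subset hbs]; omega
    obtain ⟨i, hi, hmin⟩ := Finset.exists_min_image (s \ b) z hne
    have hi' := Finset.mem_sdiff.1 hi
    refine ⟨insert i b, Finset.insert_subset hi'.1 hbs, by
      rw [Finset.card_insert_of_notMem hi'.2, hbk], ?_⟩
    intro j hj l hl
    have hl' : l ∈ s \ b := by
      simp only [Finset.mem_sdiff, Finset.mem_insert, not_or] at hl ⊢
      exact ⟨hl.1, hl.2.2⟩
    rcases Finset.mem_insert.1 hj with rfl | hj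
    · exact hmin l hl'
    · exact hb j hj l hl'

/-- The mean minimizes the sum of squared deviations. -/
lemma sum_sub_bagMean_sq_le {n : ℕ} (y : Fin n → ℝ) (b : Finset (Fin n)) (c : ℝ) :
    ∑ i ∈ b, (y i - bagMean y b) ^ 2 ≤ ∑ i ∈ b, (y i - c) ^ 2 := by
  rcases b.eq_empty_or_nonempty with rfl | hb
  · simp
  have hc : (0 : ℝ) < b.card := by exact_mod_cast hb.card_pos
  have hm : ∑ i ∈ b, (y i - bagMean y b) = 0 := by
    simp only [Finset.sum_sub_distrib, Finset.sum_const, nsmul_eq_mul, bagMean]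
    field_simp; ring
  have : ∑ i ∈ b, (y i - c) ^ 2 = ∑ i ∈ b, (y i - bagMean y b) ^ 2
      + b.card * (bagMean y b - c) ^ 2 := by
    calc ∑ i ∈ b, (y i - c) ^ 2 = ∑ i ∈ b, ((y i - bagMean y b) ^ 2
          + (2 * (bagMean y b - c) * (y i - bagMean y b) + (bagMean y b - c) ^ 2)) :=
          Finset.sum_congr rfl fun i _ => by ring
      _ = _ := by
        rw [Finset.sum_add_distrib, Finset.sum_add_distrib, ← Finset.mul_sum, hm]; simp
  rw [this]
  have := mul_nonneg hc.le (sq_nonneg (bagMean y b - c))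
  linarith

/-- A bag whose values lie in an interval costs at most a quarter of its squared length per
point, as the centre of the interval is an admissible competitor of the mean. -/
lemma sum_sub_bagMean_sq_le_of_mem_Icc {n : ℕ} (y : Fin n → ℝ) (b : Finset (Fin n)) {l u : ℝ}
    (h : ∀ i ∈ b, y i ∈ Set.Icc l u) :
    ∑ i ∈ b, (y i - bagMean y b) ^ 2 ≤ b.card * ((u - l) ^ 2 / 4) := by
  refine (sum_sub_bagMean_sq_le y b ((l + u) / 2)).trans ?_
  rw [← nsmul_eq_mul]
  refine Finset.sum_le_card_nsmul _ _ _ fun i hi => ?_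
  obtain ⟨h1, h2⟩ := h i hi
  nlinarith [mul_nonneg (sub_nonneg.2 h1) (sub_nonneg.2 h2)]

/-- Cutting the sorted values into runs of `k` gives bags of size between `k` and `2 k - 1`. The
squared lengths of the runs add up to at most the squared length of an interval that contains all
values. -/
lemma exists_finpartition_cost_le {n k : ℕ} (hk : 1 ≤ k) (z : Fin n → ℝ) (s : Finset (Fin n)) :
    ∀ l u : ℝ, (∀ i ∈ s, z i ∈ Set.Icc l u) → k ≤ s.card →
    ∃ Q : Finpartition s, (∀ b ∈ Q.parts, k ≤ b.card) ∧
      ∑ b ∈ Q.parts, ∑ i ∈ b, (z i - bagMean z b) ^ 2 ≤ 2 * k * ((u - l) ^ 2 / 4) := by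
  induction s using Finset.strongInduction with
  | H s ih =>
  intro l u hz hks
  -- a last bag of at most `2 k - 1` points, which accounts for the factor `2 k`
  by_cases hs : s.card < 2 * k
  · have hne : s ≠ ⊥ := by
      rintro rfl; simp at hks; omega
    refine ⟨Finpartition.indiscrete hne, by simpa using hks, ?_⟩
    simp only [Finpartition.indiscrete_parts, Finset.sum_singleton]
    refine (sum_sub_bagMean_sq_le_of_mem_Icc z s hz).trans ?_
    have : (s.card : ℝ) ≤ 2 * k := by exact_mod_cast hs.le
    gcongr
  · obtain ⟨b, hbs, hbk, hb⟩ := exists_subset_card_eq_forall_le z s k hks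
    have hbne : b.Nonempty := by rw [← Finset.card_pos]; omega
    obtain ⟨i₀, hi₀, hmax⟩ := Finset.exists_max_image b z hbne
    have hcard : (s \ b).card = s.card - k := by rw [Finset.card_sdiff_of_subset hbs, hbk]
    obtain ⟨Q, hQ, hQc⟩ := ih (s \ b)
      (Finset.sdiff_ssubset hbs hbne) (z i₀) u
      (fun j hj => ⟨hb i₀ hi₀ j hj, (hz j (Finset.mem_sdiff.1 hj).1).2⟩) (by omega)
    have hd : Disjoint (s \ b) b := Finset.sdiff_disjoint
    have hu : (s \ b) ⊔ b = s := Finset.sdiff_union_of_subset hbs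
    have hbQ : b ∉ Q.parts := fun h => by
      have h1 : b ≤ s \ b := Q.le h
      obtain ⟨j, hj⟩ := hbne
      exact (Finset.mem_sdiff.1 (h1 hj)).2 hj
    refine ⟨Q.extend hbne.ne_empty hd hu, ?_, ?_⟩
    · intro c hc
      simp only [Finpartition.extend_parts, Finset.mem_insert] at hc
      rcases hc with rfl | hc
      · exact hbk.ge
      · exact hQ c hc
    · rw [Finpartition.extend_parts, Finset.sum_insert hbQ]
      have h1 := sum_sub_bagMean_sq_le_of_mem_Icc z b (l := l) (u := z i₀)
        (fun j hj => ⟨(hz j (hbs hj)).1, hmax j hj⟩)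
      rw [hbk] at h1
      obtain ⟨h2, h3⟩ := hz i₀ (hbs hi₀)
      have hk0 : (0 : ℝ) ≤ k := by positivity
      have h4 : (z i₀ - l) ^ 2 + (u - z i₀) ^ 2 ≤ (u - l) ^ 2 := by
        nlinarith [mul_nonneg (sub_nonneg.2 h2) (sub_nonneg.2 h3)]
      nlinarith [mul_le_mul_of_nonneg_left h4 hk0, mul_nonneg hk0 (sq_nonneg (z i₀ - l))]

/-- An optimal bagging costs at most `2 k R²` when all predictions lie in `[-R, R]`. -/
lemma IsOptimalBagging.kMeansCost_le {n k : ℕ} (hk : 1 ≤ k) (hkn : k ≤ n) {z : Fin n → ℝ}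
    {B : Bagging n} (hB : IsOptimalBagging k z B) {R : ℝ} (hz : ∀ i, |z i| ≤ R) :
    kMeansCost z B ≤ 2 * k * R ^ 2 := by
  obtain ⟨Q, hQ, hc⟩ := exists_finpartition_cost_le hk z Finset.univ (-R) R
    (fun i _ => abs_le.1 (hz i)) (by simpa using hkn)
  calc kMeansCost z B ≤ kMeansCost z Q := hB.2 Q hQ
    _ ≤ 2 * k * ((R - -R) ^ 2 / 4) := hc
    _ = _ := by ring

/-! ### Averaging over bags -/

/-- The vector obtained from `y` by replacing every entry by the mean over its bag; this is the
orthogonal projection `Sᵀ S` applied to `y`. -/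
noncomputable def bagAverage {n : ℕ} (B : Bagging n) (y : Fin n → ℝ) (i : Fin n) : ℝ :=
  bagMean y (B.part i)

lemma bagAverage_of_mem {n : ℕ} {B : Bagging n} {b : Finset (Fin n)} (hb : b ∈ B.parts)
    {i : Fin n} (hi : i ∈ b) (y : Fin n → ℝ) : bagAverage B y i = bagMean y b := by
  rw [bagAverage, B.part_eq_of_mem hb hi]

lemma sum_parts_sum {n : ℕ} (B : Bagging n) (f : Fin n → ℝ) :
    ∑ b ∈ B.parts, ∑ i ∈ b, f i = ∑ i, f i := by
  conv_rhs => rw [← B.biUnion_parts]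
  rw [Finset.sum_biUnion B.disjoint]; rfl

lemma kMeansCost_eq_sum {n : ℕ} (y : Fin n → ℝ) (B : Bagging n) :
    kMeansCost y B = ∑ i, (y i - bagAverage B y i) ^ 2 := by
  rw [← sum_parts_sum B, kMeansCost]
  exact Finset.sum_congr rfl fun b hb => Finset.sum_congr rfl fun i hi => by
    rw [bagAverage_of_mem hb hi]

lemma eventLoss_eq_sum {n d : ℕ} (x : Fin n → EuclideanSpace ℝ (Fin d)) (y : Fin n → ℝ)
    (B : Bagging n) (t : EuclideanSpace ℝ (Fin d)) :
    eventLoss x y B t = (1 / (n : ℝ)) * ∑ i, (bagAverage B y i - linPred x t i) ^ 2 := by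
  rw [← sum_parts_sum B, eventLoss]
  congr 1
  exact Finset.sum_congr rfl fun b hb => Finset.sum_congr rfl fun i hi => by
    rw [bagAverage_of_mem hb hi, linPred]

lemma bagAverage_add {n : ℕ} (B : Bagging n) (y z : Fin n → ℝ) :
    bagAverage B (y + z) = bagAverage B y + bagAverage B z := by
  ext i; simp [bagAverage, bagMean, Finset.sum_add_distrib, add_div]

lemma card_mul_bagMean {n : ℕ} {B : Bagging n} {b : Finset (Fin n)} (hb : b ∈ B.parts)
    (y : Fin n → ℝ) : b.card * bagMean y b = ∑ i ∈ b, y i := by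
  have : (b.card : ℝ) ≠ 0 := by
    exact_mod_cast (B.nonempty_of_mem_parts hb).card_pos.ne'
  rw [bagMean]; field_simp

lemma sum_mul_bagAverage {n : ℕ} (B : Bagging n) (u v : Fin n → ℝ) :
    ∑ i, u i * bagAverage B v i = ∑ b ∈ B.parts, b.card * (bagMean u b * bagMean v b) := by
  rw [← sum_parts_sum B]
  refine Finset.sum_congr rfl fun b hb => ?_
  rw [← mul_assoc, card_mul_bagMean hb, Finset.sum_mul]
  exact Finset.sum_congr rfl fun i hi => by rw [bagAverage_of_mem hb hi]

lemma sum_mul_bagAverage_comm {n : ℕ} (B : Bagging n) (u v : Fin n → ℝ) :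
    ∑ i, u i * bagAverage B v i = ∑ i, bagAverage B u i * v i := by
  simp_rw [mul_comm (bagAverage B u _)]
  rw [sum_mul_bagAverage, sum_mul_bagAverage]
  simp_rw [mul_comm (bagMean u _)]

lemma sum_bagAverage_sq {n : ℕ} (B : Bagging n) (u : Fin n → ℝ) :
    ∑ i, bagAverage B u i ^ 2 = ∑ b ∈ B.parts, (∑ i ∈ b, u i) ^ 2 / b.card := by
  rw [← sum_parts_sum B]
  refine Finset.sum_congr rfl fun b hb => ?_
  rw [Finset.sum_congr rfl fun i hi => by rw [bagAverage_of_mem hb hi]]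
  have : (b.card : ℝ) ≠ 0 := by
    exact_mod_cast (B.nonempty_of_mem_parts hb).card_pos.ne'
  simp only [Finset.sum_const, nsmul_eq_mul, bagMean]
  field_simp

lemma sum_bagAverage_sq_le {n : ℕ} (B : Bagging n) (u : Fin n → ℝ) :
    ∑ i, bagAverage B u i ^ 2 ≤ ∑ i, u i ^ 2 := by
  rw [sum_bagAverage_sq, ← sum_parts_sum B]
  refine Finset.sum_le_sum fun b hb => ?_
  have : (0 : ℝ) < b.card := by
    exact_mod_cast (B.nonempty_of_mem_parts hb).card_pos
  rw [div_le_iff₀ this, mul_comm]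
  exact sq_sum_le_card_mul_sum_sq

lemma transpose_bagMatrix_mul_bagMatrix_mulVec {n : ℕ} (B : Bagging n) (y : Fin n → ℝ) :
    ((bagMatrix B).transpose * bagMatrix B).mulVec y = bagAverage B y := by
  ext i
  rw [← Matrix.mulVec_mulVec]
  have hi : B.part i ∈ B.parts := B.part_mem.2 (Finset.mem_univ i)
  have hm : i ∈ B.part i := B.mem_part_self.2 (Finset.mem_univ i)
  simp only [Matrix.mulVec, dotProduct, Matrix.transpose_apply]
  rw [Finset.sum_eq_single ⟨B.part i, hi⟩]
  · have : (0 : ℝ) ≤ (B.part i).card := by positivity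
    simp only [bagMatrix, hm, if_true, bagAverage, bagMean, ite_mul, zero_mul]
    rw [← Finset.sum_filter, Finset.filter_mem_eq_inter, Finset.univ_inter, ← Finset.mul_sum,
      ← mul_assoc, div_mul_div_comm, Real.mul_self_sqrt this]
    ring
  · intro b _ hb
    have : i ∉ b.1 := fun h => hb (Subtype.ext (B.part_eq_of_mem b.2 h).symm)
    simp [bagMatrix, this]
  · simp

section

/-! ### The least squares operator -/

/-- The design matrix `X`, whose rows are the feature vectors. -/
def designMatrix {n d : ℕ} (x : Fin n → EuclideanSpace ℝ (Fin d)) : Matrix (Fin n) (Fin d) ℝ :=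
  Matrix.of fun i a => x i a

/-- The least squares operator `(Xᵀ X)⁻¹ Xᵀ`; it is meaningful when `Xᵀ X` is invertible. -/
noncomputable def leastSquares {n d : ℕ} (x : Fin n → EuclideanSpace ℝ (Fin d)) :
    Matrix (Fin d) (Fin n) ℝ :=
  ((designMatrix x).transpose * designMatrix x)⁻¹ * (designMatrix x).transpose

variable {n d : ℕ} {x : Fin n → EuclideanSpace ℝ (Fin d)} {lam : ℝ}

lemma designMatrix_mulVec (x : Fin n → EuclideanSpace ℝ (Fin d)) (v : Fin d → ℝ) :
    (designMatrix x).mulVec v = linPred x (WithLp.toLp 2 v) := by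
  ext i
  simp [designMatrix, linPred, Matrix.mulVec, dotProduct, PiLp.inner_apply, mul_comm]

lemma linPred_add (x : Fin n → EuclideanSpace ℝ (Fin d)) (s t : EuclideanSpace ℝ (Fin d)) :
    linPred x (s + t) = linPred x s + linPred x t := by
  ext i; simp [linPred, inner_add_right]

lemma linPred_smul (x : Fin n → EuclideanSpace ℝ (Fin d)) (c : ℝ) (t : EuclideanSpace ℝ (Fin d)) :
    linPred x (c • t) = c • linPred x t := by
  ext i; simp [linPred, inner_smul_right]

lemma gram_mulVec_injective (hlam : 0 < lam)
    (hx : ∀ v, lam * ‖v‖ ^ 2 ≤ ∑ i, linPred x v i ^ 2) :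
    Function.Injective ((designMatrix x).transpose * designMatrix x).mulVec := by
  rw [← Matrix.coe_mulVecLin, ← LinearMap.ker_eq_bot, LinearMap.ker_eq_bot']
  intro v hv
  have h0 : ∑ i, linPred x (WithLp.toLp 2 v) i ^ 2 = 0 := by
    have h1 : dotProduct v (((designMatrix x).transpose * designMatrix x).mulVec v) = 0 := by
      have : ((designMatrix x).transpose * designMatrix x).mulVec v = 0 := hv
      rw [this, dotProduct_zero]
    rw [← Matrix.mulVec_mulVec, Matrix.dotProduct_mulVec, Matrix.vecMul_transpose,
      designMatrix_mulVec] at h1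
    simpa [dotProduct, sq] using h1
  have h2 := hx (WithLp.toLp 2 v)
  rw [h0] at h2
  have h3 : ‖(WithLp.toLp 2 v : EuclideanSpace ℝ (Fin d))‖ ^ 2 = 0 := by
    refine le_antisymm ?_ (sq_nonneg _)
    by_contra hc
    nlinarith [not_le.1 hc]
  have h4 : (WithLp.toLp 2 v : EuclideanSpace ℝ (Fin d)) = 0 := by simpa using h3
  ext a
  simpa using congrArg (fun w : EuclideanSpace ℝ (Fin d) => w a) h4

lemma isUnit_det_gram (hlam : 0 < lam) (hx : ∀ v, lam * ‖v‖ ^ 2 ≤ ∑ i, linPred x v i ^ 2) :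
    IsUnit ((designMatrix x).transpose * designMatrix x).det := by
  rw [← Matrix.isUnit_iff_isUnit_det, ← Matrix.mulVec_injective_iff_isUnit]
  exact gram_mulVec_injective hlam hx

/-- The least squares operator contracts by the factor `lam ^ (-1/2)`: the residual of a least
squares fit is orthogonal to the fitted values, which are therefore no longer than the data. -/
lemma mul_sum_leastSquares_mulVec_sq_le (hlam : 0 < lam)
    (hx : ∀ v, lam * ‖v‖ ^ 2 ≤ ∑ i, linPred x v i ^ 2) (w : Fin n → ℝ) :
    lam * ∑ a, (leastSquares x).mulVec w a ^ 2 ≤ ∑ i, w i ^ 2 := by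
  set v := (leastSquares x).mulVec w with hv
  have hG : ((designMatrix x).transpose * designMatrix x).mulVec v
      = (designMatrix x).transpose.mulVec w := by
    rw [hv, leastSquares, Matrix.mulVec_mulVec, ← Matrix.mul_assoc,
      Matrix.mul_nonsing_inv _ (isUnit_det_gram hlam hx), Matrix.one_mul]
  have h1 : ∑ i, linPred x (WithLp.toLp 2 v) i ^ 2
      = ∑ i, linPred x (WithLp.toLp 2 v) i * w i := by
    have := congrArg (dotProduct v) hG
    rw [← Matrix.mulVec_mulVec] at this
    simp only [Matrix.dotProduct_mulVec _ (Matrix.transpose _), Matrix.vecMul_transpose,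
      designMatrix_mulVec] at this
    simpa [dotProduct, sq] using this
  have h2 : ∑ i, linPred x (WithLp.toLp 2 v) i ^ 2 ≤ ∑ i, w i ^ 2 := by
    have h3 : 0 ≤ ∑ i, (linPred x (WithLp.toLp 2 v) i - w i) ^ 2 :=
      Finset.sum_nonneg fun i _ => sq_nonneg _
    have h4 : ∑ i, (linPred x (WithLp.toLp 2 v) i - w i) ^ 2
        = ∑ i, linPred x (WithLp.toLp 2 v) i ^ 2
          - 2 * ∑ i, linPred x (WithLp.toLp 2 v) i * w i + ∑ i, w i ^ 2 := by
      rw [Finset.mul_sum, ← Finset.sum_sub_distrib, ← Finset.sum_add_distrib]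
      exact Finset.sum_congr rfl fun i _ => by ring
    linarith
  have h5 := hx (WithLp.toLp 2 v)
  rw [EuclideanSpace.real_norm_sq_eq] at h5
  exact h5.trans h2

/-- Every row of the least squares operator has squared length at most `1 / lam`, as its adjoint
satisfies the same bound. -/
lemma mul_sum_leastSquares_sq_le_one (hlam : 0 < lam)
    (hx : ∀ v, lam * ‖v‖ ^ 2 ≤ ∑ i, linPred x v i ^ 2) (a : Fin d) :
    lam * ∑ i, leastSquares x a i ^ 2 ≤ 1 := by
  set s := ∑ i, leastSquares x a i ^ 2 with hs
  have hs0 : 0 ≤ s := Finset.sum_nonneg fun i _ => sq_nonneg _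
  have h1 := mul_sum_leastSquares_mulVec_sq_le hlam hx (leastSquares x a)
  have h2 : (leastSquares x).mulVec (leastSquares x a) a = s := by
    simp [Matrix.mulVec, dotProduct, hs, sq]
  have h3 : s ^ 2 ≤ ∑ a', (leastSquares x).mulVec (leastSquares x a) a' ^ 2 := by
    rw [← h2]
    exact Finset.single_le_sum (f := fun a' => (leastSquares x).mulVec (leastSquares x a) a' ^ 2)
      (fun i _ => sq_nonneg _) (Finset.mem_univ a)
  rcases hs0.eq_or_lt with h | h
  · rw [← h]; simp
  · have h4 : lam * s ^ 2 ≤ s := (mul_le_mul_of_nonneg_left h3 hlam.le).trans h1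
    nlinarith

/-- The total squared length of the bag averages of the rows of the least squares operator. Each of
the `d` rows contributes at most `1 / lam`; so does each of the bags, through the image of its
normalized indicator. -/
lemma sum_bagAverage_leastSquares_sq_le (hlam : 0 < lam)
    (hx : ∀ v, lam * ‖v‖ ^ 2 ≤ ∑ i, linPred x v i ^ 2) (B : Bagging n) :
    ∑ a, ∑ i, bagAverage B (leastSquares x a) i ^ 2 ≤ min (numBags B : ℝ) d / lam := by
  rw [le_div_iff₀ hlam, le_min_iff]
  constructor
  · have h1 : ∑ a, ∑ i, bagAverage B (leastSquares x a) i ^ 2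
        = ∑ b ∈ B.parts, (∑ a, (∑ i ∈ b, leastSquares x a i) ^ 2) / b.card := by
      simp_rw [sum_bagAverage_sq]
      rw [Finset.sum_comm]
      simp_rw [Finset.sum_div]
    rw [h1, Finset.sum_mul, numBags, Finset.card_eq_sum_ones, Nat.cast_sum]
    refine Finset.sum_le_sum fun b hb => ?_
    have hc : (0 : ℝ) < b.card := by exact_mod_cast (B.nonempty_of_mem_parts hb).card_pos
    have h2 := mul_sum_leastSquares_mulVec_sq_le hlam hx (fun i => if i ∈ b then 1 else 0)
    simp only [Matrix.mulVec, dotProduct, mul_ite, mul_one, mul_zero, ite_pow, one_pow] at h2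
    simp only [Finset.sum_ite_mem, Finset.univ_inter, ne_eq, OfNat.ofNat_ne_zero,
      not_false_eq_true, zero_pow, Finset.sum_const, nsmul_eq_mul, mul_one] at h2
    rw [Nat.cast_one, div_mul_eq_mul_div, div_le_one hc]
    linarith
  · rw [Finset.sum_mul]
    calc ∑ a, (∑ i, bagAverage B (leastSquares x a) i ^ 2) * lam ≤ ∑ _a : Fin d, (1 : ℝ) := by
          refine Finset.sum_le_sum fun a _ => ?_
          rw [mul_comm]
          exact (mul_le_mul_of_nonneg_left (sum_bagAverage_sq_le B _) hlam.le).trans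
            (mul_sum_leastSquares_sq_le_one hlam hx a)
      _ = d := by simp

/-- The first order condition for a minimizer of the event-level loss. -/
lemma sum_residual_mul_linPred_eq_zero (hn : 1 ≤ n) {y : Fin n → ℝ} {B : Bagging n}
    {t : EuclideanSpace ℝ (Fin d)} (ht : IsMinOn (eventLoss x y B) Set.univ t)
    (v : EuclideanSpace ℝ (Fin d)) :
    ∑ i, (bagAverage B y i - linPred x t i) * linPred x v i = 0 := by
  have hn0 : (0 : ℝ) < 1 / n := by
    have : (0 : ℝ) < n := by exact_mod_cast hn
    positivity
  set A := ∑ i, (bagAverage B y i - linPred x t i) * linPred x v i with hA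
  set D := ∑ i, linPred x v i ^ 2 with hD
  have hD0 : 0 ≤ D := Finset.sum_nonneg fun i _ => sq_nonneg _
  have key : ∀ s : ℝ, 0 ≤ s ^ 2 * D - 2 * s * A := by
    intro s
    have h1 : eventLoss x y B t ≤ eventLoss x y B (t + s • v) := ht (Set.mem_univ _)
    rw [eventLoss_eq_sum, eventLoss_eq_sum] at h1
    have h2 := le_of_mul_le_mul_left h1 hn0
    have h3 : ∑ i, (bagAverage B y i - linPred x (t + s • v) i) ^ 2
        = ∑ i, (bagAverage B y i - linPred x t i) ^ 2 + (s ^ 2 * D - 2 * s * A) := by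
      rw [hA, hD, Finset.mul_sum, Finset.mul_sum, ← Finset.sum_sub_distrib,
        ← Finset.sum_add_distrib]
      refine Finset.sum_congr rfl fun i _ => ?_
      rw [linPred_add, linPred_smul]
      simp only [Pi.add_apply, Pi.smul_apply, smul_eq_mul]; ring
    linarith
  -- a step that makes the right-hand side negative unless `A = 0`, also when `D = 0`
  have h := key (A / (D + 1))
  have hpos : 0 < D + 1 := by linarith
  have : (A / (D + 1)) ^ 2 * D - 2 * (A / (D + 1)) * A = - (A ^ 2 * (D + 2) / (D + 1) ^ 2) := by
    field_simp; ring
  rw [this] at h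
  have h5 : A ^ 2 * (D + 2) / (D + 1) ^ 2 ≤ 0 := by linarith
  have h6 : A ^ 2 * (D + 2) ≤ 0 := by
    by_contra hc
    exact absurd (div_pos (not_le.1 hc) (by positivity : (0 : ℝ) < (D + 1) ^ 2)) (not_lt.2 h5)
  have h7 : A ^ 2 ≤ 0 := by nlinarith [sq_nonneg A]
  exact pow_eq_zero_iff (two_ne_zero) |>.1 (le_antisymm h7 (sq_nonneg A))

/-- The coordinates of the estimation error, as an affine function of the noise `w`: a bias, the
fit of the within-bag deviations of the true responses `z`, and a linear term. -/
noncomputable def estimationError (x : Fin n → EuclideanSpace ℝ (Fin d)) (B : Bagging n)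
    (z w : Fin n → ℝ) (a : Fin d) : ℝ :=
  (leastSquares x).mulVec (bagAverage B z - z) a + ∑ i, bagAverage B (leastSquares x a) i * w i

lemma minimizer_sub_eq_estimationError (hn : 1 ≤ n) (hlam : 0 < lam)
    (hx : ∀ v, lam * ‖v‖ ^ 2 ≤ ∑ i, linPred x v i ^ 2) {B : Bagging n}
    {θ t : EuclideanSpace ℝ (Fin d)} {w y : Fin n → ℝ} (hy : y = linPred x θ + w)
    (ht : IsMinOn (eventLoss x y B) Set.univ t) (a : Fin d) :
    (t - θ) a = estimationError x B (linPred x θ) w a := by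
  set X := designMatrix x with hX
  have hdet := isUnit_det_gram hlam hx
  have hinv : ∀ v : EuclideanSpace ℝ (Fin d),
      (leastSquares x).mulVec (linPred x v) = WithLp.ofLp v := by
    intro v
    have : linPred x v = X.mulVec (WithLp.ofLp v) := by rw [hX, designMatrix_mulVec]
    rw [this, Matrix.mulVec_mulVec, leastSquares, Matrix.mul_assoc,
      Matrix.nonsing_inv_mul _ hdet, Matrix.one_mulVec]
  have hnorm : X.transpose.mulVec (bagAverage B y - linPred x t) = 0 := by
    refine dotProduct_eq _ _ fun v => ?_
    rw [zero_dotProduct, dotProduct_comm, Matrix.dotProduct_mulVec, Matrix.vecMul_transpose,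
      hX, designMatrix_mulVec]
    simpa [dotProduct, mul_comm] using
      sum_residual_mul_linPred_eq_zero hn ht (WithLp.toLp 2 v)
  have ht' : WithLp.ofLp t = (leastSquares x).mulVec (bagAverage B y) := by
    rw [← hinv t, ← sub_eq_zero, ← Matrix.mulVec_sub, leastSquares, ← Matrix.mulVec_mulVec,
      ← neg_sub, Matrix.mulVec_neg, ← hX, hnorm]
    simp
  have hadj : (leastSquares x).mulVec (bagAverage B w) a
      = ∑ i, bagAverage B (leastSquares x a) i * w i := by
    rw [← sum_mul_bagAverage_comm]; rfl
  calc (t - θ) a = (leastSquares x).mulVec (bagAverage B y) a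
        - (leastSquares x).mulVec (linPred x θ) a := by rw [hinv, ← ht']; rfl
    _ = _ := by
      rw [estimationError, ← hadj, hy, bagAverage_add, Matrix.mulVec_add, Matrix.mulVec_sub]
      simp only [Pi.add_apply, Pi.sub_apply]; ring

lemma sum_bias_sq_le (hlam : 0 < lam)
    (hx : ∀ v, lam * ‖v‖ ^ 2 ≤ ∑ i, linPred x v i ^ 2) (B : Bagging n) (z : Fin n → ℝ) :
    ∑ a, (leastSquares x).mulVec (bagAverage B z - z) a ^ 2 ≤ kMeansCost z B / lam := by
  rw [le_div_iff₀ hlam, mul_comm, kMeansCost_eq_sum]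
  refine (mul_sum_leastSquares_mulVec_sq_le hlam hx _).trans (le_of_eq ?_)
  exact Finset.sum_congr rfl fun i _ => by simp only [Pi.sub_apply]; ring

end

/-! ### Conditional risk -/

lemma lintegral_comp_prodMk_of_indepFun {Ω Ω' β : Type*} [MeasurableSpace Ω] [MeasurableSpace Ω']
    [MeasurableSpace β] {P : Measure Ω} [IsProbabilityMeasure P] {π : Ω → Ω'} {ξ : Ω → β}
    (hπ : Measurable π) (hξ : Measurable ξ) (hind : IndepFun π ξ P) {f : Ω' × β → ENNReal}
    (hf : Measurable f) :
    ∫⁻ ω, f (π ω, ξ ω) ∂P = ∫⁻ ω, ∫⁻ z, f (π ω, z) ∂P.map ξ ∂P := by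
  have : IsProbabilityMeasure (P.map ξ) := Measure.isProbabilityMeasure_map hξ.aemeasurable
  rw [← lintegral_map hf (hπ.prodMk hξ),
    (indepFun_iff_map_prod_eq_prod_map_map hπ.aemeasurable hξ.aemeasurable).1 hind,
    lintegral_prod _ hf.aemeasurable, lintegral_map hf.lintegral_prod_right' hπ]

/-- Conditionally on a `σ`-algebra that is independent of `ξ`, the variable `ξ` is integrated out
with everything else kept fixed. -/
lemma condLExp_comp_of_indep {Ω β : Type*} {m mΩ : MeasurableSpace Ω} [mβ : MeasurableSpace β]
    {P : Measure Ω} [IsProbabilityMeasure P] (hm : m ≤ mΩ) {ξ : Ω → β} (hξ : Measurable ξ)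
    (hind : Indep (MeasurableSpace.comap ξ inferInstance) m P) {f : Ω × β → ENNReal}
    (hf : Measurable[m.prod mβ] f) :
    P⁻[fun ω => f (ω, ξ ω) | m] =ᵐ[P] fun ω => ∫⁻ z, f (ω, z) ∂P.map ξ := by
  have : IsProbabilityMeasure (P.map ξ) := Measure.isProbabilityMeasure_map hξ.aemeasurable
  have hid : @Measurable Ω Ω mΩ m id := fun s hs => hm s hs
  have hind' : @IndepFun Ω Ω β mΩ m mβ id ξ P := by
    refine (@IndepFun_iff_Indep Ω Ω β mΩ m mβ id ξ P).2 ?_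
    rw [MeasurableSpace.comap_id]
    exact hind.symm
  refine (ae_eq_condLExp hm P _ (@Measurable.lintegral_prod_right' Ω β m mβ _ _ f hf) ?_).symm
  intro s hs
  have hg : Measurable[m.prod mβ] ((Prod.fst ⁻¹' s).indicator f) :=
    hf.indicator (@measurable_fst Ω β m mβ s hs)
  have h := @lintegral_comp_prodMk_of_indepFun Ω Ω β mΩ m mβ P _ id ξ hid hξ hind' _ hg
  rw [← lintegral_indicator (hm s hs), ← lintegral_indicator (hm s hs)]
  have e1 : ∀ ω, s.indicator (fun ω => f (ω, ξ ω)) ω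
      = (Prod.fst ⁻¹' s).indicator f (id ω, ξ ω) := fun ω => by
    by_cases hω : ω ∈ s <;> simp [Set.indicator, hω]
  have e2 : ∀ ω, s.indicator (fun ω => ∫⁻ z, f (ω, z) ∂P.map ξ) ω
      = ∫⁻ z, (Prod.fst ⁻¹' s).indicator f (id ω, z) ∂P.map ξ := fun ω => by
    by_cases hω : ω ∈ s <;> simp [Set.indicator, hω]
  simp_rw [e1, e2, h]

/-- Two functions that agree almost everywhere on an `m`-measurable event have the same conditional
expectation there. -/
lemma condLExp_ae_eq_on {Ω : Type*} {m mΩ : MeasurableSpace Ω} {P : Measure Ω}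
    [IsProbabilityMeasure P] (hm : m ≤ mΩ) {f g : Ω → ENNReal} {E : Set Ω}
    (hE : MeasurableSet[m] E) (hfg : ∀ᵐ ω ∂P, ω ∈ E → f ω = g ω) :
    ∀ᵐ ω ∂P, ω ∈ E → P⁻[f | m] ω = P⁻[g | m] ω := by
  have key : ∀ f : Ω → ENNReal, E.indicator (P⁻[f | m]) =ᵐ[P] P⁻[E.indicator f | m] := fun f => by
    refine ae_eq_condLExp hm P _ ((measurable_condLExp m P f).indicator hE) fun s hs => ?_
    rw [← lintegral_indicator (hm s hs), ← lintegral_indicator (hm s hs), Set.indicator_indicator,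
      Set.indicator_indicator, lintegral_indicator (hm _ (hs.inter hE)),
      lintegral_indicator (hm _ (hs.inter hE)), setLIntegral_condLExp hm P f (hs.inter hE)]
  have h : E.indicator f =ᵐ[P] E.indicator g := by
    filter_upwards [hfg] with ω hω
    by_cases h : ω ∈ E <;> simp [h, hω]
  filter_upwards [key f, key g, condLExp_congr_ae (mΩ := m) h] with ω h1 h2 h3 hω
  rw [← Set.indicator_of_mem hω (P⁻[f | m]), h1, h3, ← h2, Set.indicator_of_mem hω]

/-- The second moment of an affine function of centred, uncorrelated noise. -/
lemma lintegral_sum_affine_sq {Ω : Type*} [MeasurableSpace Ω] {P : Measure Ω}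
    [IsProbabilityMeasure P] {n d : ℕ} {σ : ℝ} {ξ : Ω → Fin n → ℝ} (hξ : Measurable ξ)
    (hξ2 : ∀ i, MemLp (fun ω => ξ ω i) 2 P) (hξ0 : ∀ i, ∫ ω, ξ ω i ∂P = 0)
    (hcov : ∀ i j, ∫ ω, ξ ω i * ξ ω j ∂P = if i = j then σ ^ 2 else 0)
    (b : Fin d → ℝ) (A : Fin d → Fin n → ℝ) :
    ∫⁻ z, ENNReal.ofReal (∑ a, (b a + ∑ i, A a i * z i) ^ 2) ∂P.map ξ
      = ENNReal.ofReal (∑ a, b a ^ 2 + σ ^ 2 * ∑ a, ∑ i, A a i ^ 2) := by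
  rw [lintegral_map (by fun_prop) hξ]
  have hI : ∀ i j, Integrable (fun ω => ξ ω i * ξ ω j) P := fun i j =>
    (hξ2 i).integrable_mul (hξ2 j)
  have hI1 : ∀ i, Integrable (fun ω => ξ ω i) P := fun i =>
    (hξ2 i).integrable (by norm_num)
  have hexp : ∀ ω a, (b a + ∑ i, A a i * ξ ω i) ^ 2 = b a ^ 2 + ∑ i, 2 * b a * A a i * ξ ω i
      + ∑ i, ∑ j, A a i * A a j * (ξ ω i * ξ ω j) := fun ω a => by
    rw [add_sq, sq (∑ i, A a i * ξ ω i), Finset.sum_mul_sum, Finset.mul_sum]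
    congr 1
    · congr 1
      exact Finset.sum_congr rfl fun i _ => by ring
    · exact Finset.sum_congr rfl fun i _ => Finset.sum_congr rfl fun j _ => by ring
  have hIlin : ∀ a, Integrable (fun ω => ∑ i, 2 * b a * A a i * ξ ω i) P := fun a =>
    integrable_finsetSum _ fun i _ => (hI1 i).const_mul _
  have hIrow : ∀ a i, Integrable (fun ω => ∑ j, A a i * A a j * (ξ ω i * ξ ω j)) P := fun a i =>
    integrable_finsetSum _ fun j _ => (hI i j).const_mul _
  have hIquad : ∀ a, Integrable (fun ω => ∑ i, ∑ j, A a i * A a j * (ξ ω i * ξ ω j)) P :=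
    fun a => integrable_finsetSum _ fun i _ => hIrow a i
  have hint : ∀ a, Integrable (fun ω => (b a + ∑ i, A a i * ξ ω i) ^ 2) P := fun a => by
    simp_rw [hexp]
    exact ((integrable_const _).add (hIlin a)).add (hIquad a)
  rw [← ofReal_integral_eq_lintegral_ofReal (integrable_finsetSum _ fun a _ => hint a)
    (Filter.Eventually.of_forall fun ω => Finset.sum_nonneg fun a _ => sq_nonneg _),
    integral_finsetSum _ fun a _ => hint a, Finset.mul_sum, ← Finset.sum_add_distrib]
  congr 1
  refine Finset.sum_congr rfl fun a _ => ?_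
  simp_rw [hexp]
  have hIaff : Integrable (fun ω => b a ^ 2 + ∑ i, 2 * b a * A a i * ξ ω i) P :=
    (integrable_const _).add (hIlin a)
  rw [integral_add hIaff (hIquad a),
    integral_add (integrable_const _) (hIlin a), integral_const,
    integral_finsetSum _ fun i _ => (hI1 i).const_mul _,
    integral_finsetSum _ fun i _ => hIrow a i]
  simp_rw [fun i => integral_finsetSum Finset.univ
    (fun j _ => ((hI i j).const_mul (A a i * A a j))), integral_const_mul, hξ0, hcov]
  simp only [probReal_univ, smul_eq_mul, one_mul, mul_zero, Finset.sum_const_zero,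
    add_zero, mul_ite, Finset.sum_ite_eq, Finset.mem_univ, if_true, Finset.mul_sum]
  congr 1
  exact Finset.sum_congr rfl fun i _ => by ring

lemma continuous_designMatrix {n d : ℕ} :
    Continuous fun x : Fin n → EuclideanSpace ℝ (Fin d) => designMatrix x := by
  refine continuous_matrix fun i a => ?_
  simp only [designMatrix, Matrix.of_apply]
  fun_prop

lemma continuous_gram {n d : ℕ} : Continuous fun x : Fin n → EuclideanSpace ℝ (Fin d) =>
    (designMatrix x).transpose * designMatrix x :=
  continuous_designMatrix.matrix_transpose.matrix_mul continuous_designMatrix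

lemma measurable_leastSquares {n d : ℕ} (a : Fin d) (i : Fin n) :
    Measurable fun x : Fin n → EuclideanSpace ℝ (Fin d) => leastSquares x a i := by
  have hentry : ∀ x : Fin n → EuclideanSpace ℝ (Fin d), leastSquares x a i
      = (((designMatrix x).transpose * designMatrix x).det)⁻¹
        * (((designMatrix x).transpose * designMatrix x).adjugate
          * (designMatrix x).transpose) a i := fun x => by
    rw [leastSquares, Matrix.inv_def, Ring.inverse_eq_inv', Matrix.smul_mul, Matrix.smul_apply,
      smul_eq_mul]
  simp_rw [hentry]
  exact continuous_gram.matrix_det.measurable.inv.mul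
    ((continuous_gram.matrix_adjugate.matrix_mul
      continuous_designMatrix.matrix_transpose).matrix_elem a i).measurable

lemma measurable_sum_estimationError_sq {Ω : Type*} [MeasurableSpace Ω] {n d : ℕ}
    {X : Fin n → Ω → EuclideanSpace ℝ (Fin d)} (hX : ∀ i, Measurable (X i))
    {B : Ω → Bagging n} (hB : ∀ b, MeasurableSet {ω | B ω = b}) (θ : EuclideanSpace ℝ (Fin d)) :
    Measurable fun p : Ω × (Fin n → ℝ) => ENNReal.ofReal (∑ a,
      estimationError (fun i => X i p.1) (B p.1) (linPred (fun i => X i p.1) θ) p.2 a ^ 2) := by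
  have hL : ∀ a i, Measurable fun ω => leastSquares (fun i => X i ω) a i := fun a i =>
    (measurable_leastSquares a i).comp (measurable_pi_lambda _ hX)
  have hfix : ∀ B₀ : Bagging n, Measurable fun p : Ω × (Fin n → ℝ) => ENNReal.ofReal (∑ a,
      estimationError (fun i => X i p.1) B₀ (linPred (fun i => X i p.1) θ) p.2 a ^ 2) := by
    intro B₀
    have hL' : ∀ a i, Measurable fun p : Ω × (Fin n → ℝ) => leastSquares (fun i => X i p.1) a i :=
      fun a i => (hL a i).comp measurable_fst
    have hz : ∀ i, Measurable fun p : Ω × (Fin n → ℝ) => inner ℝ (X i p.1) θ := fun i =>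
      ((hX i).comp measurable_fst).inner measurable_const
    simp only [estimationError, Matrix.mulVec, dotProduct, bagAverage, bagMean, linPred,
      Pi.sub_apply]
    fun_prop
  classical
  have hsum : (fun p : Ω × (Fin n → ℝ) => ENNReal.ofReal (∑ a,
      estimationError (fun i => X i p.1) (B p.1) (linPred (fun i => X i p.1) θ) p.2 a ^ 2))
      = fun p => ∑ B₀ : Bagging n, (Prod.fst ⁻¹' {ω | B ω = B₀}).indicator
        (fun p => ENNReal.ofReal (∑ a, estimationError (fun i => X i p.1) B₀
          (linPred (fun i => X i p.1) θ) p.2 a ^ 2)) p := by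
    funext p
    rw [Finset.sum_eq_single (B p.1)]
    · simp
    · intro B₀ _ hB₀
      simp [Set.indicator, hB₀.symm]
    · simp
  rw [hsum]
  exact Finset.measurable_sum _ fun B₀ _ => (hfix B₀).indicator (measurable_fst (hB B₀))

/-- The conditional risk of the estimator built from bags that are known given `𝒢`, on an event
where the Gram matrix is bounded below: the within-bag variation of the true responses is the bias,
and the noise contributes `σ²` for each of at most `min (m, d)` directions. -/
lemma condLExp_sq_norm_sub_le {Ω : Type*} {𝒢 mΩ : MeasurableSpace Ω} {P : Measure Ω}
    [IsProbabilityMeasure P] {n d : ℕ} (hn : 1 ≤ n) {X : Fin n → Ω → EuclideanSpace ℝ (Fin d)}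
    {θ : EuclideanSpace ℝ (Fin d)} {σ : ℝ} {ξ y : Ω → Fin n → ℝ}
    (hξ : Measurable ξ) (hξ2 : ∀ i, MemLp (fun ω => ξ ω i) 2 P) (hξ0 : ∀ i, ∫ ω, ξ ω i ∂P = 0)
    (hcov : ∀ i j, ∫ ω, ξ ω i * ξ ω j ∂P = if i = j then σ ^ 2 else 0)
    (hy : ∀ ω i, y ω i = inner ℝ (X i ω) θ + ξ ω i)
    (h𝒢 : 𝒢 ≤ mΩ) (hX : ∀ i, Measurable[𝒢] (X i))
    (hind : Indep (MeasurableSpace.comap ξ inferInstance) 𝒢 P)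
    {E : Set Ω} (hE : MeasurableSet[𝒢] E) {lam : ℝ} (hlam : 0 < lam)
    (hgram : ∀ ω ∈ E, ∀ v, lam * ‖v‖ ^ 2 ≤ ∑ i, linPred (fun i => X i ω) v i ^ 2)
    {B : Ω → Bagging n} (hB : ∀ b, MeasurableSet[𝒢] {ω | B ω = b})
    {θhat : Ω → EuclideanSpace ℝ (Fin d)}
    (hmin : ∀ᵐ ω ∂P, IsMinOn (eventLoss (fun i => X i ω) (y ω) (B ω)) Set.univ (θhat ω)) :
    ∀ᵐ ω ∂P, ω ∈ E → P⁻[fun ω' => ENNReal.ofReal (‖θhat ω' - θ‖ ^ 2) | 𝒢] ω ≤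
      ENNReal.ofReal ((kMeansCost (linPred (fun i => X i ω) θ) (B ω)
        + σ ^ 2 * min (numBags (B ω) : ℝ) d) / lam) := by
  have hf := @measurable_sum_estimationError_sq Ω 𝒢 n d X hX B hB θ
  have h1 := condLExp_comp_of_indep h𝒢 hξ hind hf
  have h2 := condLExp_ae_eq_on (P := P) h𝒢 hE
    (f := fun ω => ENNReal.ofReal (‖θhat ω - θ‖ ^ 2))
    (g := fun ω => ENNReal.ofReal (∑ a, estimationError (fun i => X i ω) (B ω)
      (linPred (fun i => X i ω) θ) (ξ ω) a ^ 2)) (by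
      filter_upwards [hmin] with ω hω hωE
      rw [EuclideanSpace.real_norm_sq_eq]
      congr 1
      refine Finset.sum_congr rfl fun a _ => ?_
      rw [minimizer_sub_eq_estimationError hn hlam (hgram ω hωE)
        (w := ξ ω) (funext fun i => by simp [hy ω i, linPred]) hω])
  filter_upwards [h1, h2] with ω hω1 hω2 hωE
  rw [hω2 hωE, hω1]
  simp only [estimationError]
  rw [lintegral_sum_affine_sq hξ hξ2 hξ0 hcov]
  refine ENNReal.ofReal_le_ofReal ?_
  rw [add_div, mul_div_assoc]
  exact add_le_add (sum_bias_sq_le hlam (hgram ω hωE) _ _)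
    (mul_le_mul_of_nonneg_left
      (sum_bagAverage_leastSquares_sq_le hlam (hgram ω hωE) _) (sq_nonneg σ))

section

/-! ### Sums of independent subexponential variables -/

lemma exp_mul_le_of_abs_le {K lam z : ℝ} (hK : 0 < K) (hlam : |lam| ≤ 1 / (2 * K)) :
    Real.exp (lam * z) ≤ 1 + lam * z + 8 * lam ^ 2 * K ^ 2 * Real.exp (|z| / K) := by
  have h1 : Real.exp (lam * z) ≤ 1 + lam * z + |lam * z| ^ 2 * Real.exp |lam * z| := by
    have := Complex.norm_exp_sub_sum_le_norm_mul_exp (lam * z : ℝ) 2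
    simp only [Finset.sum_range_succ, Finset.sum_range_zero, Nat.factorial] at this
    norm_num at this
    have h2 : (Complex.exp (lam * z) - (1 + lam * z)) =
        ((Real.exp (lam * z) - (1 + lam * z) : ℝ) : ℂ) := by push_cast; ring
    rw [h2, Complex.norm_real, Real.norm_eq_abs] at this
    have h3 := (le_abs_self _).trans this
    rw [abs_mul]
    linarith
  set s := |z| / K with hs
  have hs0 : 0 ≤ s := by positivity
  have hz : |z| = s * K := by rw [hs]; field_simp
  have h2 : |lam * z| ≤ s / 2 := by
    rw [abs_mul, hz]
    calc |lam| * (s * K) ≤ 1 / (2 * K) * (s * K) := by gcongr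
      _ = s / 2 := by field_simp
  have h3 : s ^ 2 ≤ 8 * Real.exp (s / 2) := by
    have := Real.quadratic_le_exp_of_nonneg (x := s / 2) (by positivity)
    nlinarith
  have h4 : |lam * z| ^ 2 * Real.exp |lam * z| ≤ 8 * lam ^ 2 * K ^ 2 * Real.exp s := by
    calc |lam * z| ^ 2 * Real.exp |lam * z| ≤ |lam * z| ^ 2 * Real.exp (s / 2) := by gcongr
      _ = lam ^ 2 * K ^ 2 * (s ^ 2 * Real.exp (s / 2)) := by
        rw [abs_mul, hz, mul_pow, sq_abs]; ring
      _ ≤ lam ^ 2 * K ^ 2 * (8 * Real.exp (s / 2) * Real.exp (s / 2)) := by gcongr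
      _ = 8 * lam ^ 2 * K ^ 2 * Real.exp s := by
        rw [mul_assoc 8, ← Real.exp_add, add_halves]; ring
  linarith

variable {Ω : Type*} [MeasurableSpace Ω] {P : Measure Ω}

lemma integrable_of_integrable_exp_abs {Z : Ω → ℝ} {K : ℝ} (hK : 0 < K) (hZ : Measurable Z)
    (hint : Integrable (fun ω => Real.exp (|Z ω| / K)) P) : Integrable Z P := by
  refine (hint.const_mul K).mono' hZ.aestronglyMeasurable (Filter.Eventually.of_forall fun ω => ?_)
  have := Real.add_one_le_exp (|Z ω| / K)
  have h2 : K * (|Z ω| / K + 1) ≤ K * Real.exp (|Z ω| / K) := by gcongr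
  have h3 : K * (|Z ω| / K + 1) = |Z ω| + K := by field_simp
  rw [Real.norm_eq_abs]; linarith

lemma integrable_exp_mul_of_abs_le {Z : Ω → ℝ} {K lam : ℝ} (hK : 0 < K)
    (hlam : |lam| ≤ 1 / (2 * K)) (hZ : Measurable Z)
    (hint : Integrable (fun ω => Real.exp (|Z ω| / K)) P) :
    Integrable (fun ω => Real.exp (lam * Z ω)) P := by
  refine hint.mono' (by fun_prop) (Filter.Eventually.of_forall fun ω => ?_)
  rw [Real.norm_eq_abs, abs_of_pos (Real.exp_pos _), Real.exp_le_exp]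
  calc lam * Z ω ≤ |lam| * |Z ω| := by rw [← abs_mul]; exact le_abs_self _
    _ ≤ 1 / K * |Z ω| := by
      gcongr
      exact hlam.trans (one_div_le_one_div_of_le hK (by linarith))
    _ = |Z ω| / K := by ring

variable [IsProbabilityMeasure P]

lemma mgf_le_of_integral_exp_abs_le {Z : Ω → ℝ} {K lam μ : ℝ} (hK : 0 < K)
    (hlam : |lam| ≤ 1 / (2 * K)) (hZ : Measurable Z)
    (hint : Integrable (fun ω => Real.exp (|Z ω| / K)) P)
    (h2 : ∫ ω, Real.exp (|Z ω| / K) ∂P ≤ 2) (hμ : ∫ ω, Z ω ∂P = μ) :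
    mgf Z P lam ≤ Real.exp (lam * μ + 16 * lam ^ 2 * K ^ 2) := by
  have hZi := integrable_of_integrable_exp_abs hK hZ hint
  have hi1 : Integrable (fun ω => 1 + lam * Z ω) P := (integrable_const _).add (hZi.const_mul _)
  calc mgf Z P lam
      ≤ ∫ ω, (1 + lam * Z ω + 8 * lam ^ 2 * K ^ 2 * Real.exp (|Z ω| / K)) ∂P :=
        integral_mono (integrable_exp_mul_of_abs_le hK hlam hZ hint)
          (hi1.add (hint.const_mul _)) fun ω => exp_mul_le_of_abs_le hK hlam
    _ = 1 + lam * μ + 8 * lam ^ 2 * K ^ 2 * ∫ ω, Real.exp (|Z ω| / K) ∂P := by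
        rw [integral_add hi1 (hint.const_mul _), integral_add (integrable_const _)
          (hZi.const_mul _), integral_const_mul, integral_const_mul, hμ]
        simp
    _ ≤ 1 + lam * μ + 8 * lam ^ 2 * K ^ 2 * 2 := by gcongr
    _ ≤ Real.exp (lam * μ + 16 * lam ^ 2 * K ^ 2) := by
        have := Real.add_one_le_exp (lam * μ + 16 * lam ^ 2 * K ^ 2)
        linarith

/-- Upper tail of **Bernstein's inequality**, with the parameter `t / (32 K²)` in Chernoff's
bound. -/
lemma measure_sum_ge_le_of_integral_exp_abs_le {n : ℕ} {Z : Fin n → Ω → ℝ} {K μ t : ℝ} (hK : 0 < K)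
    (hZ : ∀ i, Measurable (Z i)) (hind : iIndepFun Z P)
    (hint : ∀ i, Integrable (fun ω => Real.exp (|Z i ω| / K)) P)
    (h2 : ∀ i, ∫ ω, Real.exp (|Z i ω| / K) ∂P ≤ 2) (hμ : ∀ i, ∫ ω, Z i ω ∂P = μ)
    (ht0 : 0 ≤ t) (ht : t ≤ 16 * K) :
    P.real {ω | n * t ≤ ∑ i, Z i ω - n * μ} ≤ Real.exp (-(n * t ^ 2 / (64 * K ^ 2))) := by
  set lam := t / (32 * K ^ 2) with hlam_def
  have hlam0 : 0 ≤ lam := by positivity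
  have hlam : |lam| ≤ 1 / (2 * K) := by
    rw [abs_of_nonneg hlam0, hlam_def, div_le_div_iff₀ (by positivity) (by positivity)]
    nlinarith
  have hset : {ω | n * t ≤ ∑ i, Z i ω - n * μ} = {ω | n * t + n * μ ≤ (∑ i, Z i) ω} := by
    ext ω; simp only [Set.mem_ofPred_eq, Finset.sum_apply]; constructor <;> intro h <;> linarith
  rw [hset]
  have hint_sum : Integrable (fun ω => Real.exp (lam * (∑ i, Z i) ω)) P :=
    hind.integrable_exp_mul_sum hZ fun i _ => integrable_exp_mul_of_abs_le hK hlam (hZ i) (hint i)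
  refine (measure_ge_le_exp_mul_mgf _ hlam0 hint_sum).trans ?_
  rw [hind.mgf_sum hZ]
  calc Real.exp (-lam * (n * t + n * μ)) * ∏ i, mgf (Z i) P lam
      ≤ Real.exp (-lam * (n * t + n * μ))
        * ∏ _i : Fin n, Real.exp (lam * μ + 16 * lam ^ 2 * K ^ 2) := by
        gcongr with i
        · exact fun i _ => mgf_nonneg
        · exact mgf_le_of_integral_exp_abs_le hK hlam (hZ i) (hint i) (h2 i) (hμ i)
    _ = Real.exp (-lam * (n * t + n * μ) + n * (lam * μ + 16 * lam ^ 2 * K ^ 2)) := by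
        rw [Finset.prod_const, ← Real.exp_nat_mul, ← Real.exp_add]; simp
    _ = Real.exp (-(n * t ^ 2 / (64 * K ^ 2))) := by
        congr 1
        rw [hlam_def]; field_simp; ring

/-- **Bernstein's inequality** in the subgaussian range, for independent variables with the same
mean and `𝔼 exp (|Z i| / K) ≤ 2`. -/
lemma measure_abs_sum_ge_le_of_integral_exp_abs_le {n : ℕ} {Z : Fin n → Ω → ℝ} {K μ t : ℝ}
    (hK : 0 < K) (hZ : ∀ i, Measurable (Z i)) (hind : iIndepFun Z P)
    (hint : ∀ i, Integrable (fun ω => Real.exp (|Z i ω| / K)) P)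
    (h2 : ∀ i, ∫ ω, Real.exp (|Z i ω| / K) ∂P ≤ 2) (hμ : ∀ i, ∫ ω, Z i ω ∂P = μ)
    (ht0 : 0 ≤ t) (ht : t ≤ 16 * K) :
    P.real {ω | n * t ≤ |∑ i, Z i ω - n * μ|}
      ≤ 2 * Real.exp (-(n * t ^ 2 / (64 * K ^ 2))) := by
  have hup := measure_sum_ge_le_of_integral_exp_abs_le hK hZ hind hint h2 hμ ht0 ht
  have hlo := measure_sum_ge_le_of_integral_exp_abs_le (Z := fun i ω => -Z i ω) (μ := -μ) hK
    (fun i => (hZ i).neg) (hind.comp (fun _ x => -x) fun _ => measurable_neg)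
    (by simpa using hint) (by simpa using h2) (fun i => by rw [integral_neg, hμ]) ht0 ht
  have hsub : {ω | n * t ≤ |∑ i, Z i ω - n * μ|} ⊆ {ω | n * t ≤ ∑ i, Z i ω - n * μ}
      ∪ {ω | n * t ≤ ∑ i, -Z i ω - n * -μ} := by
    intro ω hω
    rcases le_abs.1 (show n * t ≤ |∑ i, Z i ω - n * μ| from hω) with h | h
    · exact Or.inl h
    · refine Or.inr ?_
      simp only [Set.mem_ofPred_eq, Finset.sum_neg_distrib]
      linarith
  calc _ ≤ _ := measureReal_mono hsub
    _ ≤ _ := measureReal_union_le _ _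
    _ ≤ _ := by linarith

/-! ### A net of the sphere -/

/-- A maximal `1/2`-separated subset of the unit sphere is a `1/2`-net, and comparing volumes bounds
its cardinality. -/
lemma exists_finset_net_sphere (E : Type*) [NormedAddCommGroup E] [NormedSpace ℝ E]
    [FiniteDimensional ℝ E] :
    ∃ N : Finset E, N.card ≤ 5 ^ Module.finrank ℝ E ∧ (∀ u ∈ N, ‖u‖ = 1) ∧
      ∀ u : E, ‖u‖ = 1 → ∃ w ∈ N, ‖u - w‖ ≤ 1 / 2 := by
  classical
  let Sep : Finset E → Prop := fun s =>
    (∀ u ∈ s, ‖u‖ = 1) ∧ ∀ u ∈ s, ∀ w ∈ s, u ≠ w → 1 / 2 ≤ ‖u - w‖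
  have hcard : ∀ s, Sep s → s.card ≤ 5 ^ Module.finrank ℝ E := by
    intro s hs
    have hinj : Function.Injective fun u : E => (2 : ℝ) • u := smul_right_injective E two_ne_zero
    rw [← Finset.card_image_of_injective s hinj]
    refine Besicovitch.card_le_of_separated _ ?_ ?_
    · intro c hc
      obtain ⟨u, hu, rfl⟩ := Finset.mem_image.1 hc
      simp [norm_smul, hs.1 u hu]
    · intro c hc c' hc' hne
      obtain ⟨u, hu, rfl⟩ := Finset.mem_image.1 hc
      obtain ⟨w, hw, rfl⟩ := Finset.mem_image.1 hc'
      have := hs.2 u hu w hw fun h => hne (by rw [h])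
      rw [← smul_sub, norm_smul, Real.norm_eq_abs, abs_two]
      linarith
  let Q : ℕ → Prop := fun m => ∃ s, Sep s ∧ s.card = m
  have hQ0 : Q 0 := ⟨∅, ⟨by simp, by simp⟩, rfl⟩
  obtain ⟨N, hN, hNcard⟩ : Q (Nat.findGreatest Q (5 ^ Module.finrank ℝ E)) :=
    Nat.findGreatest_spec (Nat.zero_le _) hQ0
  refine ⟨N, hcard N hN, hN.1, fun u hu => ?_⟩
  by_contra! hfar
  have huN : u ∉ N := fun h => by
    have := hfar u h
    rw [sub_self, norm_zero] at this
    linarith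
  have hins : Sep (insert u N) := by
    refine ⟨fun w hw => ?_, fun w hw w' hw' hne => ?_⟩
    · rcases Finset.mem_insert.1 hw with rfl | hw
      · exact hu
      · exact hN.1 w hw
    · rcases Finset.mem_insert.1 hw with rfl | h <;> rcases Finset.mem_insert.1 hw' with rfl | h'
      · exact absurd rfl hne
      · exact (hfar w' h').le
      · rw [norm_sub_rev]; exact (hfar w h).le
      · exact hN.2 w h w' h' hne
  have hle := Nat.le_findGreatest (hcard _ hins) (show Q _ from ⟨_, hins, rfl⟩)
  rw [Finset.card_insert_of_notMem huN, hNcard] at hle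
  omega

/-- The operator norm is at most four times the maximum of the bilinear form over a `1/2`-net: each
of the two arguments costs a factor two. -/
lemma opNorm_le_of_net {E : Type*} [NormedAddCommGroup E] [InnerProductSpace ℝ E]
    {N : Finset E} (hN : ∀ u : E, ‖u‖ = 1 → ∃ w ∈ N, ‖u - w‖ ≤ 1 / 2) (A : E →L[ℝ] E) {t : ℝ}
    (ht : 0 ≤ t) (hA : ∀ u ∈ N, ∀ v ∈ N, |inner ℝ u (A v)| ≤ t) : ‖A‖ ≤ 4 * t := by
  have h1 : ∀ v ∈ N, ‖A v‖ ≤ 2 * t := by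
    intro v hv
    by_cases h0 : A v = 0
    · rw [h0, norm_zero]; linarith
    have hpos : 0 < ‖A v‖ := norm_pos_iff.2 h0
    obtain ⟨w, hw, hwu⟩ := hN (‖A v‖⁻¹ • A v) (by
      rw [norm_smul, norm_inv, norm_norm, inv_mul_cancel₀ hpos.ne'])
    have h2 : ‖A v‖ = inner ℝ w (A v) + inner ℝ (‖A v‖⁻¹ • A v - w) (A v) := by
      rw [← inner_add_left, add_sub_cancel, inner_smul_left, real_inner_self_eq_norm_sq]
      simp only [conj_trivial]
      field_simp
    have h3 := (le_abs_self _).trans (hA w hw v hv)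
    have h4 : inner ℝ (‖A v‖⁻¹ • A v - w) (A v) ≤ 1 / 2 * ‖A v‖ :=
      (real_inner_le_norm _ _).trans (by gcongr)
    linarith
  have h5 : ‖A‖ ≤ 2 * t + ‖A‖ / 2 := by
    refine A.opNorm_le_of_unit_norm (by positivity) fun v hv => ?_
    obtain ⟨w, hw, hvw⟩ := hN v hv
    calc ‖A v‖ = ‖A w + A (v - w)‖ := by rw [← map_add, add_sub_cancel]
      _ ≤ ‖A w‖ + ‖A (v - w)‖ := norm_add_le _ _
      _ ≤ 2 * t + ‖A‖ * (1 / 2) := by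
        gcongr
        · exact h1 w hw
        · exact (A.le_opNorm _).trans (by gcongr)
      _ = 2 * t + ‖A‖ / 2 := by ring
  linarith

end

/-! ### Extreme singular values -/

section SingularValues

lemma norm_sq_eq_sum_repr_sq {E : Type*} [NormedAddCommGroup E] [InnerProductSpace ℝ E] {d : ℕ}
    (b : OrthonormalBasis (Fin d) ℝ E) (v : E) :
    ‖v‖ ^ 2 = ∑ i, b.repr v i ^ 2 := by
  rw [← b.repr.norm_map, EuclideanSpace.real_norm_sq_eq]

variable {E : Type*} [NormedAddCommGroup E] [InnerProductSpace ℝ E] [FiniteDimensional ℝ E]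

lemma inner_self_apply_eq_sum_eigenvalues {T : E →ₗ[ℝ] E} (hT : T.IsSymmetric) {d : ℕ}
    (hd : Module.finrank ℝ E = d) (v : E) :
    inner ℝ v (T v) = ∑ i, hT.eigenvalues hd i * (hT.eigenvectorBasis hd).repr v i ^ 2 := by
  rw [← (hT.eigenvectorBasis hd).repr.inner_map_map, PiLp.inner_apply]
  refine Finset.sum_congr rfl fun i _ => ?_
  rw [hT.eigenvectorBasis_apply_self_apply]
  simp only [RCLike.ofReal_real_eq_id, id_eq, RCLike.inner_apply, conj_trivial]
  ring

lemma norm_apply_sq_eq_sum_singularValues (T : E →ₗ[ℝ] E) {d : ℕ} (hd : Module.finrank ℝ E = d)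
    (v : E) : ‖T v‖ ^ 2 = ∑ i : Fin d, T.singularValues i ^ 2
      * (T.isSymmetric_adjoint_comp_self.eigenvectorBasis hd).repr v i ^ 2 := by
  have h := inner_self_apply_eq_sum_eigenvalues T.isSymmetric_adjoint_comp_self hd v
  rw [LinearMap.comp_apply, LinearMap.adjoint_inner_right, real_inner_self_eq_norm_sq] at h
  simp_rw [h, T.sq_singularValues_fin hd]

lemma singularValues_pred_mul_norm_le (T : E →ₗ[ℝ] E) (v : E) :
    T.singularValues (Module.finrank ℝ E - 1) * ‖v‖ ≤ ‖T v‖ := by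
  refine le_of_sq_le_sq ?_ (norm_nonneg _)
  rw [mul_pow, norm_apply_sq_eq_sum_singularValues T rfl, norm_sq_eq_sum_repr_sq
    (T.isSymmetric_adjoint_comp_self.eigenvectorBasis rfl), Finset.mul_sum]
  gcongr with i
  · exact T.singularValues_nonneg _
  · exact T.singularValues_antitone (by omega)

lemma norm_apply_le_singularValues_zero_mul_norm (T : E →ₗ[ℝ] E) (v : E) :
    ‖T v‖ ≤ T.singularValues 0 * ‖v‖ := by
  refine le_of_sq_le_sq ?_ (mul_nonneg (T.singularValues_nonneg _) (norm_nonneg _))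
  rw [mul_pow, norm_apply_sq_eq_sum_singularValues T rfl, norm_sq_eq_sum_repr_sq
    (T.isSymmetric_adjoint_comp_self.eigenvectorBasis rfl), Finset.mul_sum]
  gcongr with i
  · exact T.singularValues_nonneg _
  · exact T.singularValues_antitone (Nat.zero_le _)

/-- A positive operator that expands norms by `c` has a quadratic form bounded below by `c`, since
its eigenvalues are the expansion factors of its eigenvectors. -/
lemma mul_norm_sq_le_inner_of_isPositive {T : E →ₗ[ℝ] E} (hT : T.IsPositive) {c : ℝ}
    (hc : ∀ v, c * ‖v‖ ≤ ‖T v‖) (v : E) : c * ‖v‖ ^ 2 ≤ inner ℝ v (T v) := by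
  rw [inner_self_apply_eq_sum_eigenvalues hT.isSymmetric rfl,
    norm_sq_eq_sum_repr_sq (hT.isSymmetric.eigenvectorBasis rfl), Finset.mul_sum]
  gcongr with i
  have h := hc (hT.isSymmetric.eigenvectorBasis rfl i)
  rw [hT.isSymmetric.apply_eigenvectorBasis, norm_smul, OrthonormalBasis.norm_eq_one] at h
  have h0 := hT.nonneg_eigenvalues rfl i
  simpa [abs_of_nonneg h0] using h

end SingularValues

lemma sigmaMin_mul_norm_sq_le_inner {d : ℕ} {M : Matrix (Fin d) (Fin d) ℝ} (hM : M.PosSemidef)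
    (v : EuclideanSpace ℝ (Fin d)) :
    sigmaMin M * ‖v‖ ^ 2 ≤ inner ℝ v (Matrix.toEuclideanCLM (𝕜 := ℝ) M v) := by
  refine mul_norm_sq_le_inner_of_isPositive (T := Matrix.toEuclideanLin M)
    (Matrix.isPositive_toEuclideanLin_iff.2 hM) (fun v => ?_) v
  have := singularValues_pred_mul_norm_le (Matrix.toEuclideanLin M) v
  rwa [finrank_euclideanSpace_fin] at this

lemma inner_le_sigmaMax_mul_norm_sq {d : ℕ} (M : Matrix (Fin d) (Fin d) ℝ)
    (v : EuclideanSpace ℝ (Fin d)) :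
    inner ℝ v (Matrix.toEuclideanCLM (𝕜 := ℝ) M v) ≤ sigmaMax M * ‖v‖ ^ 2 := by
  have h : ‖Matrix.toEuclideanCLM (𝕜 := ℝ) M v‖ ≤ sigmaMax M * ‖v‖ :=
    norm_apply_le_singularValues_zero_mul_norm (Matrix.toEuclideanLin M) v
  calc _ ≤ ‖v‖ * ‖Matrix.toEuclideanCLM (𝕜 := ℝ) M v‖ := real_inner_le_norm _ _
    _ ≤ ‖v‖ * (sigmaMax M * ‖v‖) := by gcongr
    _ = _ := by ring

/-! ### Subgaussian vectors -/

lemma exp_abs_mul_div_le (p q κ : ℝ) : Real.exp (|p * q| / κ ^ 2)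
    ≤ (Real.exp (p ^ 2 / κ ^ 2) + Real.exp (q ^ 2 / κ ^ 2)) / 2 := by
  set s := Real.exp (p ^ 2 / κ ^ 2 / 2)
  set r := Real.exp (q ^ 2 / κ ^ 2 / 2)
  have h1 : |p * q| ≤ p ^ 2 / 2 + q ^ 2 / 2 := by
    rw [abs_mul, ← sq_abs p, ← sq_abs q]
    nlinarith [sq_nonneg (|p| - |q|)]
  have h2 : Real.exp (|p * q| / κ ^ 2) ≤ s * r := by
    rw [← Real.exp_add, Real.exp_le_exp]
    calc |p * q| / κ ^ 2 ≤ (p ^ 2 / 2 + q ^ 2 / 2) / κ ^ 2 := by gcongr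
      _ = _ := by ring
  have h3 : Real.exp (p ^ 2 / κ ^ 2) = s ^ 2 := by rw [← Real.exp_nat_mul]; congr 1; push_cast; ring
  have h4 : Real.exp (q ^ 2 / κ ^ 2) = r ^ 2 := by rw [← Real.exp_nat_mul]; congr 1; push_cast; ring
  rw [h3, h4]
  nlinarith [sq_nonneg (s - r)]

namespace IsSubgaussianVector

variable {Ω : Type*} [MeasurableSpace Ω] {P : Measure Ω} {d : ℕ}
  {x : Ω → EuclideanSpace ℝ (Fin d)} {κ : ℝ}

lemma integrable_exp (hx : IsSubgaussianVector x κ P) (hm : Measurable x)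
    {u : EuclideanSpace ℝ (Fin d)} (hu : ‖u‖ = 1) :
    Integrable (fun ω => Real.exp ((inner ℝ u (x ω)) ^ 2 / κ ^ 2)) P := by
  rw [← lintegral_ofReal_ne_top_iff_integrable (by fun_prop)
    (Filter.Eventually.of_forall fun ω => (Real.exp_pos _).le)]
  exact ((hx u hu).trans_lt (by norm_num)).ne

lemma integral_exp_le (hx : IsSubgaussianVector x κ P) (hm : Measurable x)
    {u : EuclideanSpace ℝ (Fin d)} (hu : ‖u‖ = 1) :
    ∫ ω, Real.exp ((inner ℝ u (x ω)) ^ 2 / κ ^ 2) ∂P ≤ 2 := by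
  have h := hx u hu
  rw [← ofReal_integral_eq_lintegral_ofReal (hx.integrable_exp hm hu)
    (Filter.Eventually.of_forall fun ω => (Real.exp_pos _).le)] at h
  exact ENNReal.ofReal_le_ofNat.1 h

/-- Products of two unit marginals are subexponential, by the inequality of arithmetic and geometric
means. -/
lemma integrable_exp_abs_mul (hx : IsSubgaussianVector x κ P) (hm : Measurable x)
    {u v : EuclideanSpace ℝ (Fin d)} (hu : ‖u‖ = 1) (hv : ‖v‖ = 1) :
    Integrable (fun ω => Real.exp (|inner ℝ u (x ω) * inner ℝ v (x ω)| / κ ^ 2)) P := by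
  refine (((hx.integrable_exp hm hu).add (hx.integrable_exp hm hv)).div_const 2).mono'
    (by fun_prop) (Filter.Eventually.of_forall fun ω => ?_)
  rw [Real.norm_eq_abs, abs_of_pos (Real.exp_pos _)]
  exact exp_abs_mul_div_le _ _ _

lemma integral_exp_abs_mul_le (hx : IsSubgaussianVector x κ P) (hm : Measurable x)
    {u v : EuclideanSpace ℝ (Fin d)} (hu : ‖u‖ = 1) (hv : ‖v‖ = 1) :
    ∫ ω, Real.exp (|inner ℝ u (x ω) * inner ℝ v (x ω)| / κ ^ 2) ∂P ≤ 2 := by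
  have hiu := hx.integrable_exp hm hu
  have hiv := hx.integrable_exp hm hv
  calc _ ≤ ∫ ω, (Real.exp ((inner ℝ u (x ω)) ^ 2 / κ ^ 2)
        + Real.exp ((inner ℝ v (x ω)) ^ 2 / κ ^ 2)) / 2 ∂P :=
        integral_mono (hx.integrable_exp_abs_mul hm hu hv) ((hiu.add hiv).div_const 2)
          fun ω => exp_abs_mul_div_le _ _ _
    _ ≤ 2 := by
        rw [integral_div, integral_add hiu hiv]
        linarith [hx.integral_exp_le hm hu, hx.integral_exp_le hm hv]

lemma integrable_apply_mul_apply (hx : IsSubgaussianVector x κ P) (hκ : 0 < κ)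
    (hm : Measurable x) (a b : Fin d) : Integrable (fun ω => x ω a * x ω b) P := by
  have h := integrable_of_integrable_exp_abs (by positivity : 0 < κ ^ 2) (by fun_prop)
    (hx.integrable_exp_abs_mul hm (u := EuclideanSpace.single a 1) (v := EuclideanSpace.single b 1)
      (by simp) (by simp))
  simpa [EuclideanSpace.inner_single_left] using h

/-- The matrix of second moments represents the second moments of all marginals. -/
lemma integral_inner_mul_inner (hx : IsSubgaussianVector x κ P) (hκ : 0 < κ) (hm : Measurable x)
    {M : Matrix (Fin d) (Fin d) ℝ} (hM : ∀ a b, ∫ ω, x ω a * x ω b ∂P = M a b)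
    (u v : EuclideanSpace ℝ (Fin d)) :
    ∫ ω, inner ℝ u (x ω) * inner ℝ v (x ω) ∂P
      = inner ℝ u (Matrix.toEuclideanCLM (𝕜 := ℝ) M v) := by
  have h1 : ∀ ω, inner ℝ u (x ω) * inner ℝ v (x ω)
      = ∑ a, ∑ b, u a * v b * (x ω a * x ω b) := fun ω => by
    simp only [PiLp.inner_apply, RCLike.inner_apply, conj_trivial]
    rw [Finset.sum_mul_sum]
    exact Finset.sum_congr rfl fun a _ => Finset.sum_congr rfl fun b _ => by ring
  have hi : ∀ a b, Integrable (fun ω => u a * v b * (x ω a * x ω b)) P := fun a b =>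
    (hx.integrable_apply_mul_apply hκ hm a b).const_mul _
  simp_rw [h1]
  rw [integral_finsetSum _ fun a _ => integrable_finsetSum _ fun b _ => hi a b,
    Matrix.inner_toEuclideanCLM]
  simp only [dotProduct, Matrix.mulVec]
  refine Finset.sum_congr rfl fun a _ => ?_
  rw [integral_finsetSum _ fun b _ => hi a b, Finset.mul_sum]
  refine Finset.sum_congr rfl fun b _ => ?_
  rw [integral_const_mul, hM]; ring

lemma posSemidef_secondMoment (hx : IsSubgaussianVector x κ P) (hκ : 0 < κ) (hm : Measurable x)
    {M : Matrix (Fin d) (Fin d) ℝ} (hM : ∀ a b, ∫ ω, x ω a * x ω b ∂P = M a b) :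
    M.PosSemidef := by
  refine Matrix.PosSemidef.of_dotProduct_mulVec_nonneg ?_ fun v => ?_
  · ext a b
    simp only [Matrix.conjTranspose_apply, star_trivial, ← hM]
    simp_rw [mul_comm]
  · have h := hx.integral_inner_mul_inner hκ hm hM (WithLp.toLp 2 v) (WithLp.toLp 2 v)
    rw [Matrix.inner_toEuclideanCLM] at h
    rw [star_trivial, ← h]
    exact integral_nonneg fun ω => mul_self_nonneg _

/-- The second moments of unit marginals are at most `κ²`, as `s + 1 ≤ exp s`. -/
lemma sigmaMin_le [IsProbabilityMeasure P] (hx : IsSubgaussianVector x κ P) (hκ : 0 < κ)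
    (hm : Measurable x) {M : Matrix (Fin d) (Fin d) ℝ}
    (hM : ∀ a b, ∫ ω, x ω a * x ω b ∂P = M a b) (hd : 1 ≤ d) : sigmaMin M ≤ κ ^ 2 := by
  set u : EuclideanSpace ℝ (Fin d) := EuclideanSpace.single ⟨0, hd⟩ 1 with hu_def
  have hu : ‖u‖ = 1 := by simp [hu_def]
  have h1 := sigmaMin_mul_norm_sq_le_inner (hx.posSemidef_secondMoment hκ hm hM) u
  rw [hu, one_pow, mul_one, ← hx.integral_inner_mul_inner hκ hm hM] at h1
  have hi := hx.integrable_exp hm hu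
  have hi2 := integrable_of_integrable_exp_abs (by positivity : 0 < κ ^ 2) (by fun_prop)
    (hx.integrable_exp_abs_mul hm hu hu)
  have h2 : ∫ ω, inner ℝ u (x ω) * inner ℝ u (x ω) ∂P
      ≤ ∫ ω, κ ^ 2 * (Real.exp ((inner ℝ u (x ω)) ^ 2 / κ ^ 2) - 1) ∂P := by
    refine integral_mono hi2 ((hi.sub (integrable_const 1)).const_mul _) fun ω => ?_
    have := Real.add_one_le_exp ((inner ℝ u (x ω)) ^ 2 / κ ^ 2)
    calc inner ℝ u (x ω) * inner ℝ u (x ω) = κ ^ 2 * ((inner ℝ u (x ω)) ^ 2 / κ ^ 2) := by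
          field_simp
      _ ≤ _ := by gcongr; linarith
  rw [integral_const_mul, integral_sub hi (integrable_const 1)] at h2
  have h3 := hx.integral_exp_le hm hu
  simp only [integral_const, probReal_univ, smul_eq_mul, mul_one] at h2
  have h4 : κ ^ 2 * (∫ ω, Real.exp ((inner ℝ u (x ω)) ^ 2 / κ ^ 2) ∂P - 1) ≤ κ ^ 2 * 1 := by
    gcongr; linarith
  linarith

/-- The tail bound for a marginal, from Markov's inequality for `exp (⟨u, x⟩² / κ²)`. -/
lemma measure_lt_abs_inner_le [IsProbabilityMeasure P] (hx : IsSubgaussianVector x κ P)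
    (hκ : 0 < κ) (hm : Measurable x) (θ : EuclideanSpace ℝ (Fin d)) {s : ℝ} (hs : 0 ≤ s) :
    P.real {ω | κ * ‖θ‖ * s < |inner ℝ (x ω) θ|} ≤ 2 * Real.exp (-s ^ 2) := by
  by_cases hθ : θ = 0
  · simp only [hθ, norm_zero, mul_zero, zero_mul, inner_zero_right, abs_zero, lt_self_iff_false]
    simp only [Set.ofPred_false, measureReal_empty]
    positivity
  have hpos : 0 < ‖θ‖ := norm_pos_iff.2 hθ
  set u := ‖θ‖⁻¹ • θ with hu_def
  have hu : ‖u‖ = 1 := by rw [hu_def, norm_smul, norm_inv, norm_norm, inv_mul_cancel₀ hpos.ne']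
  have hsub : {ω | κ * ‖θ‖ * s < |inner ℝ (x ω) θ|}
      ⊆ {ω | Real.exp (s ^ 2) ≤ Real.exp ((inner ℝ u (x ω)) ^ 2 / κ ^ 2)} := by
    intro ω hω
    have hω' : κ * ‖θ‖ * s < |inner ℝ (x ω) θ| := hω
    have h1 : inner ℝ (x ω) θ = ‖θ‖ * inner ℝ u (x ω) := by
      rw [hu_def, inner_smul_left, real_inner_comm, conj_trivial]; field_simp
    rw [h1, abs_mul, abs_of_pos hpos] at hω'
    have h2 : κ * s < |inner ℝ u (x ω)| := by
      refine lt_of_mul_lt_mul_left ?_ hpos.le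
      linarith
    rw [Set.mem_ofPred_eq, Real.exp_le_exp, le_div_iff₀ (by positivity), ← mul_pow,
      ← sq_abs (inner ℝ u (x ω)), mul_comm]
    exact pow_le_pow_left₀ (by positivity) h2.le 2
  refine (measureReal_mono hsub).trans ?_
  have := mul_meas_ge_le_integral_of_nonneg (μ := P)
    (Filter.Eventually.of_forall fun ω => (Real.exp_pos ((inner ℝ u (x ω)) ^ 2 / κ ^ 2)).le)
    (hx.integrable_exp hm hu) (Real.exp (s ^ 2))
  have h2 := this.trans (hx.integral_exp_le hm hu)
  rw [Real.exp_neg, ← div_eq_mul_inv, le_div_iff₀ (Real.exp_pos _), mul_comm]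
  exact h2

end IsSubgaussianVector

section

/-! ### Concentration of the Gram matrix -/

/-- The deviation of the empirical second moments `n⁻¹ Xᵀ X` from the matrix `M`, as an operator. -/
noncomputable def gramDeviation {n d : ℕ} (M : Matrix (Fin d) (Fin d) ℝ)
    (x : Fin n → EuclideanSpace ℝ (Fin d)) :
    EuclideanSpace ℝ (Fin d) →L[ℝ] EuclideanSpace ℝ (Fin d) :=
  Matrix.toEuclideanCLM (𝕜 := ℝ)
    ((n : ℝ)⁻¹ • ((designMatrix x).transpose * designMatrix x) - M)

variable {n d : ℕ}

lemma inner_gramDeviation (M : Matrix (Fin d) (Fin d) ℝ) (x : Fin n → EuclideanSpace ℝ (Fin d))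
    (u v : EuclideanSpace ℝ (Fin d)) :
    inner ℝ u (gramDeviation M x v) = (n : ℝ)⁻¹ * ∑ i, inner ℝ u (x i) * inner ℝ v (x i)
      - inner ℝ u (Matrix.toEuclideanCLM (𝕜 := ℝ) M v) := by
  rw [gramDeviation, Matrix.inner_toEuclideanCLM, Matrix.inner_toEuclideanCLM, Matrix.sub_mulVec,
    dotProduct_sub, Matrix.smul_mulVec, dotProduct_smul, smul_eq_mul, ← Matrix.mulVec_mulVec,
    Matrix.dotProduct_mulVec, Matrix.vecMul_transpose, designMatrix_mulVec, designMatrix_mulVec]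
  simp only [dotProduct, linPred, WithLp.toLp_ofLp]
  simp_rw [fun i => real_inner_comm u (x i), fun i => real_inner_comm v (x i)]

lemma measurable_norm_gramDeviation (M : Matrix (Fin d) (Fin d) ℝ) :
    Measurable fun x : Fin n → EuclideanSpace ℝ (Fin d) => ‖gramDeviation M x‖ := by
  have hA : Continuous fun x : Fin n → EuclideanSpace ℝ (Fin d) =>
      (n : ℝ)⁻¹ • ((designMatrix x).transpose * designMatrix x) - M :=
    (continuous_gram.const_smul (n : ℝ)⁻¹).sub (continuous_const (y := M))
  have hT : Continuous fun A : Matrix (Fin d) (Fin d) ℝ => Matrix.toEuclideanCLM (𝕜 := ℝ) A :=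
    LinearMap.continuous_of_finiteDimensional
      ({ toFun := Matrix.toEuclideanCLM (n := Fin d) (𝕜 := ℝ)
         map_add' := map_add _
         map_smul' := map_smul _ } : Matrix (Fin d) (Fin d) ℝ →ₗ[ℝ] _)
  exact (hT.comp hA).norm.measurable

lemma sum_linPred_sq_eq (hn : 1 ≤ n) (M : Matrix (Fin d) (Fin d) ℝ)
    (x : Fin n → EuclideanSpace ℝ (Fin d)) (v : EuclideanSpace ℝ (Fin d)) :
    ∑ i, linPred x v i ^ 2 = n * (inner ℝ v (Matrix.toEuclideanCLM (𝕜 := ℝ) M v)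
      + inner ℝ v (gramDeviation M x v)) := by
  have hn0 : (n : ℝ) ≠ 0 := by exact_mod_cast (by omega : n ≠ 0)
  rw [inner_gramDeviation, add_sub_cancel, mul_inv_cancel_left₀ hn0]
  exact Finset.sum_congr rfl fun i _ => by rw [linPred, real_inner_comm, sq]

lemma abs_inner_gramDeviation_le (M : Matrix (Fin d) (Fin d) ℝ)
    (x : Fin n → EuclideanSpace ℝ (Fin d)) (v : EuclideanSpace ℝ (Fin d)) :
    |inner ℝ v (gramDeviation M x v)| ≤ ‖gramDeviation M x‖ * ‖v‖ ^ 2 := by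
  calc _ ≤ ‖v‖ * ‖gramDeviation M x v‖ := abs_real_inner_le_norm _ _
    _ ≤ ‖v‖ * (‖gramDeviation M x‖ * ‖v‖) := by gcongr; exact ContinuousLinearMap.le_opNorm _ _
    _ = _ := by ring

lemma mul_norm_sq_le_sum_linPred_sq (hn : 1 ≤ n) {M : Matrix (Fin d) (Fin d) ℝ}
    (hM : M.PosSemidef) {x : Fin n → EuclideanSpace ℝ (Fin d)} {τ : ℝ}
    (hx : ‖gramDeviation M x‖ ≤ τ) (v : EuclideanSpace ℝ (Fin d)) :
    n * (sigmaMin M - τ) * ‖v‖ ^ 2 ≤ ∑ i, linPred x v i ^ 2 := by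
  rw [sum_linPred_sq_eq hn M, mul_assoc]
  have h1 := sigmaMin_mul_norm_sq_le_inner hM v
  have h2 := (neg_le_of_abs_le (abs_inner_gramDeviation_le M x v))
  have h3 := mul_le_mul_of_nonneg_right hx (sq_nonneg ‖v‖)
  gcongr
  linarith

lemma sum_linPred_sq_le (hn : 1 ≤ n) (M : Matrix (Fin d) (Fin d) ℝ)
    {x : Fin n → EuclideanSpace ℝ (Fin d)} {τ : ℝ}
    (hx : ‖gramDeviation M x‖ ≤ τ) (v : EuclideanSpace ℝ (Fin d)) :
    ∑ i, linPred x v i ^ 2 ≤ n * (sigmaMax M + τ) * ‖v‖ ^ 2 := by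
  rw [sum_linPred_sq_eq hn M, mul_assoc]
  have h1 := inner_le_sigmaMax_mul_norm_sq M v
  have h2 := (le_abs_self _).trans (abs_inner_gramDeviation_le M x v)
  have h3 := mul_le_mul_of_nonneg_right hx (sq_nonneg ‖v‖)
  gcongr
  linarith

variable {Ω : Type*} [MeasurableSpace Ω] {P : Measure Ω} [IsProbabilityMeasure P]

/-- Concentration of the empirical second moments. Bernstein's inequality applies to the bilinear
form at each of at most `25 ^ d` pairs of points of a net; at deviation `32 κ² √(d / n)` its
exponent is `- 16 d`, which outweighs the number of pairs. -/
lemma measure_lt_norm_gramDeviation_le {κ : ℝ} (hκ : 0 < κ) (hn : 1 ≤ n)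
    {X : Fin n → Ω → EuclideanSpace ℝ (Fin d)} {M : Matrix (Fin d) (Fin d) ℝ}
    (hX : ∀ i, Measurable (X i)) (hind : iIndepFun X P)
    (hsub : ∀ i, IsSubgaussianVector (X i) κ P)
    (hM : ∀ i a b, ∫ ω, X i ω a * X i ω b ∂P = M a b) (hdn : √((d : ℝ) / n) ≤ 1 / 2) :
    P.real {ω | 128 * κ ^ 2 * √((d : ℝ) / n) < ‖gramDeviation M fun i => X i ω‖}
      ≤ 2 * Real.exp (-d) := by
  obtain ⟨N, hNcard, hNunit, hNnet⟩ := exists_finset_net_sphere (EuclideanSpace ℝ (Fin d))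
  rw [finrank_euclideanSpace_fin] at hNcard
  have hn0 : (0 : ℝ) < n := by exact_mod_cast hn
  set t := 32 * κ ^ 2 * √((d : ℝ) / n) with ht_def
  have ht0 : 0 ≤ t := by positivity
  let bad : EuclideanSpace ℝ (Fin d) × EuclideanSpace ℝ (Fin d) → Set Ω := fun p =>
    {ω | n * t ≤ |∑ i, inner ℝ p.1 (X i ω) * inner ℝ p.2 (X i ω)
      - n * inner ℝ p.1 (Matrix.toEuclideanCLM (𝕜 := ℝ) M p.2)|}
  have hcover : {ω | 128 * κ ^ 2 * √((d : ℝ) / n) < ‖gramDeviation M fun i => X i ω‖}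
      ⊆ ⋃ p ∈ N ×ˢ N, bad p := by
    intro ω hω
    by_contra hgood
    simp only [Set.mem_iUnion, not_exists] at hgood
    refine absurd (opNorm_le_of_net hNnet (gramDeviation M fun i => X i ω) ht0 ?_)
      (not_le.2 (lt_of_eq_of_lt (by rw [ht_def]; ring) hω))
    intro u hu v hv
    have h := hgood (u, v) (Finset.mem_product.2 ⟨hu, hv⟩)
    have h' : |∑ i, inner ℝ u (X i ω) * inner ℝ v (X i ω)
        - n * inner ℝ u (Matrix.toEuclideanCLM (𝕜 := ℝ) M v)| ≤ n * t := (not_le.1 h).le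
    rw [inner_gramDeviation]
    refine le_of_mul_le_mul_left ?_ hn0
    rw [← abs_of_pos hn0, ← abs_mul, mul_sub, abs_of_pos hn0, mul_inv_cancel_left₀ hn0.ne']
    exact h'
  have hbad : ∀ p ∈ N ×ˢ N, P.real (bad p) ≤ 2 * Real.exp (-(16 * d)) := by
    intro p hp
    obtain ⟨hu, hv⟩ := Finset.mem_product.1 hp
    have h := measure_abs_sum_ge_le_of_integral_exp_abs_le (P := P) (K := κ ^ 2) (t := t)
      (Z := fun i ω => inner ℝ p.1 (X i ω) * inner ℝ p.2 (X i ω))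
      (μ := inner ℝ p.1 (Matrix.toEuclideanCLM (𝕜 := ℝ) M p.2)) (by positivity)
      (fun i => by have := hX i; fun_prop)
      (hind.comp (fun _ x => inner ℝ p.1 x * inner ℝ p.2 x) fun _ => by fun_prop)
      (fun i => (hsub i).integrable_exp_abs_mul (hX i) (hNunit _ hu) (hNunit _ hv))
      (fun i => (hsub i).integral_exp_abs_mul_le (hX i) (hNunit _ hu) (hNunit _ hv))
      (fun i => (hsub i).integral_inner_mul_inner hκ (hX i) (hM i) _ _) ht0
      (by rw [ht_def]; nlinarith [sq_nonneg κ])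
    refine h.trans (le_of_eq ?_)
    congr 2
    rw [ht_def, mul_pow, Real.sq_sqrt (by positivity)]
    field_simp
    ring
  calc _ ≤ P.real (⋃ p ∈ N ×ˢ N, bad p) :=
      measureReal_mono hcover (measure_ne_top _ _)
    _ ≤ ∑ p ∈ N ×ˢ N, P.real (bad p) := measureReal_biUnion_finset_le _ _
    _ ≤ ∑ _p ∈ N ×ˢ N, 2 * Real.exp (-(16 * d)) := Finset.sum_le_sum hbad
    _ = ((N.card : ℝ) * N.card) * (2 * Real.exp (-(16 * d))) := by
      rw [Finset.sum_const, Finset.card_product, nsmul_eq_mul]; push_cast; ring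
    _ ≤ ((5 : ℝ) ^ d * 5 ^ d) * (2 * Real.exp (-(16 * d))) := by
      have : (N.card : ℝ) ≤ 5 ^ d := by exact_mod_cast hNcard
      gcongr
    _ ≤ (Real.exp d ^ 5 * Real.exp d ^ 5) * (2 * Real.exp (-(16 * d))) := by
      have h5 : (5 : ℝ) ^ d ≤ Real.exp d ^ 5 := by
        have : (5 : ℝ) ≤ Real.exp 5 := by linarith [Real.add_one_le_exp 5]
        calc (5 : ℝ) ^ d ≤ Real.exp 5 ^ d := by gcongr
          _ = _ := by rw [← Real.exp_nat_mul, ← Real.exp_nat_mul]; congr 1; push_cast; ring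
      gcongr
    _ = 2 * Real.exp (-(6 * d)) := by
      rw [← Real.exp_nat_mul, ← Real.exp_add, mul_left_comm, ← Real.exp_add]
      congr 2; push_cast; ring
    _ ≤ 2 * Real.exp (-d) := by
      gcongr
      have : (0 : ℝ) ≤ d := by positivity
      linarith

/-- All true responses are small with probability `1 - 1 / n`, by a union bound over the samples. -/
lemma measure_exists_lt_abs_inner_le {κ : ℝ} (hκ : 0 < κ) (hn : 1 ≤ n)
    {X : Fin n → Ω → EuclideanSpace ℝ (Fin d)} (hX : ∀ i, Measurable (X i))
    (hsub : ∀ i, IsSubgaussianVector (X i) κ P) (θ : EuclideanSpace ℝ (Fin d)) :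
    P.real {ω | ∃ i, κ * ‖θ‖ * (2 * √(Real.log n)) < |inner ℝ (X i ω) θ|} ≤ 1 / n := by
  -- for `n = 1` the threshold is `0` and the bound is trivial; for `n ≥ 2` the union bound gives
  -- `2 n / n ^ 4 ≤ 1 / n`
  rcases hn.eq_or_lt with rfl | hn2
  · simp
  have hn0 : (0 : ℝ) < n := by exact_mod_cast hn
  have hn2' : (2 : ℝ) ≤ n := by exact_mod_cast hn2
  have hlog : 0 ≤ Real.log n := Real.log_nonneg (by linarith)
  have hexp : Real.exp (-(2 * √(Real.log n)) ^ 2) = ((n : ℝ) ^ 4)⁻¹ := by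
    rw [mul_pow, Real.sq_sqrt hlog, Real.exp_neg,
      show (2 : ℝ) ^ 2 * Real.log n = (4 : ℕ) * Real.log n by norm_num, Real.exp_nat_mul,
      Real.exp_log hn0]
  have hset : {ω | ∃ i, κ * ‖θ‖ * (2 * √(Real.log n)) < |inner ℝ (X i ω) θ|}
      = ⋃ i, {ω | κ * ‖θ‖ * (2 * √(Real.log n)) < |inner ℝ (X i ω) θ|} := by
    ext ω; simp
  rw [hset]
  calc _ ≤ ∑ i, P.real {ω | κ * ‖θ‖ * (2 * √(Real.log n)) < |inner ℝ (X i ω) θ|} :=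
        measureReal_iUnion_fintype_le _
    _ ≤ ∑ _i : Fin n, 2 * ((n : ℝ) ^ 4)⁻¹ := by
      refine Finset.sum_le_sum fun i _ => ?_
      rw [← hexp]
      exact (hsub i).measure_lt_abs_inner_le hκ (hX i) θ (by positivity)
    _ = 2 / (n : ℝ) ^ 3 := by
      rw [Finset.sum_const, nsmul_eq_mul, Finset.card_univ, Fintype.card_fin]
      field_simp
    _ ≤ 1 / n := by
      rw [div_le_div_iff₀ (by positivity) hn0]
      nlinarith [mul_le_mul hn2' hn2' (by norm_num) hn0.le]

/-! ### Bias of an approximate bagging -/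

/-- Passing from one bagging to another changes the within-bag deviations by the difference of the
two projections; the two contributions are separated by the weighted inequality
`(p + q)² ≤ (1 + 1 / η) p² + (1 + η) q²`. -/
lemma kMeansCost_le_of_opNorm_le {B B' : Bagging n} {ε η : ℝ} (hη : 0 < η)
    (hε : opNorm ((bagMatrix B).transpose * bagMatrix B
      - (bagMatrix B').transpose * bagMatrix B') ≤ ε) (z : Fin n → ℝ) :
    kMeansCost z B' ≤ (1 + 1 / η) * kMeansCost z B + (1 + η) * (ε ^ 2 * ∑ i, z i ^ 2) := by
  have hdiff : ∑ i, (bagAverage B z i - bagAverage B' z i) ^ 2 ≤ ε ^ 2 * ∑ i, z i ^ 2 := by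
    have h := (ContinuousLinearMap.le_of_opNorm_le _ hε (WithLp.toLp 2 z))
    rw [Matrix.toEuclideanCLM_toLp, Matrix.sub_mulVec, transpose_bagMatrix_mul_bagMatrix_mulVec,
      transpose_bagMatrix_mul_bagMatrix_mulVec] at h
    have h2 := pow_le_pow_left₀ (norm_nonneg _) h 2
    rw [mul_pow, EuclideanSpace.real_norm_sq_eq, EuclideanSpace.real_norm_sq_eq] at h2
    simpa using h2
  have hpoint : ∀ p q : ℝ, (p + q) ^ 2 ≤ (1 + 1 / η) * p ^ 2 + (1 + η) * q ^ 2 := fun p q => by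
    have h : (1 + 1 / η) * p ^ 2 + (1 + η) * q ^ 2 - (p + q) ^ 2 = (p - η * q) ^ 2 / η := by
      field_simp; ring
    have h2 : 0 ≤ (p - η * q) ^ 2 / η := by positivity
    linarith
  rw [kMeansCost_eq_sum, kMeansCost_eq_sum]
  calc ∑ i, (z i - bagAverage B' z i) ^ 2
      = ∑ i, ((z i - bagAverage B z i) + (bagAverage B z i - bagAverage B' z i)) ^ 2 :=
        Finset.sum_congr rfl fun i _ => by ring
    _ ≤ ∑ i, ((1 + 1 / η) * (z i - bagAverage B z i) ^ 2
        + (1 + η) * (bagAverage B z i - bagAverage B' z i) ^ 2) :=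
        Finset.sum_le_sum fun i _ => hpoint _ _
    _ = (1 + 1 / η) * ∑ i, (z i - bagAverage B z i) ^ 2
        + (1 + η) * ∑ i, (bagAverage B z i - bagAverage B' z i) ^ 2 := by
        rw [Finset.sum_add_distrib, Finset.mul_sum, Finset.mul_sum]
    _ ≤ _ := by gcongr

end

end AggregateLearning

theorem mainTheorem6 (κ : ℝ) (hκ : 0 < κ) :
    -- constants that depend only on `κ`
    ∃ C > (0 : ℝ), ∃ c > (0 : ℝ),
    ∀ {Ω : Type*} {𝒢 mΩ : MeasurableSpace Ω} (P : Measure Ω) [IsProbabilityMeasure P]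
      (n d k : ℕ) (_ : 1 ≤ k) (_ : k ≤ n)
      -- i.i.d. subgaussian features with second moment matrix `M`
      (X : Fin n → Ω → EuclideanSpace ℝ (Fin d)) (M : Matrix (Fin d) (Fin d) ℝ)
      (_ : ∀ i, Measurable (X i)) (_ : iIndepFun X P)
      (_ : ∀ i j, IdentDistrib (X i) (X j) P P)
      (_ : ∀ i, AggregateLearning.IsSubgaussianVector (X i) κ P)
      (_ : ∀ i a b, ∫ ω, X i ω a * X i ω b ∂P = M a b)
      (_ : C * √((d : ℝ) / n) < AggregateLearning.sigmaMin M)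
      -- the linear model `y = X θ + ξ`
      (θ : EuclideanSpace ℝ (Fin d)) (σ : ℝ) (ξ y : Ω → Fin n → ℝ)
      (_ : Measurable ξ) (_ : ∀ i, MemLp (fun ω => ξ ω i) 2 P)
      (_ : ∀ i, ∫ ω, ξ ω i ∂P = 0)
      (_ : ∀ i j, ∫ ω, ξ ω i * ξ ω j ∂P = if i = j then σ ^ 2 else 0)
      (_ : ∀ ω i, y ω i = inner ℝ (X i ω) θ + ξ ω i)
      -- `𝒢`: what is known when the bags are formed; it contains the features and is independent
      -- of the noise
      (_ : 𝒢 ≤ mΩ) (_ : ∀ i, Measurable[𝒢] (X i))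
      (_ : Indep (MeasurableSpace.comap ξ inferInstance) 𝒢 P),
    -- the high-probability event is determined by the features
    ∃ E : Set Ω,
      MeasurableSet[MeasurableSpace.comap (fun ω i => X i ω) inferInstance] E ∧
      1 - 1 / (n : ℝ) - 2 * Real.exp (-(c * d)) ≤ P.real E ∧
      ∀ B : Ω → AggregateLearning.Bagging n,
        -- the optimal bags, for the true prior `X θ`
        (∀ᵐ ω ∂P, AggregateLearning.IsOptimalBagging k
          (AggregateLearning.linPred (fun i => X i ω) θ) (B ω)) →
        -- the bound for the estimator that uses the optimal bags
        (∀ θhat : Ω → EuclideanSpace ℝ (Fin d), Measurable θhat →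
          (∀ b, MeasurableSet[𝒢] {ω | B ω = b}) →
          (∀ᵐ ω ∂P, IsMinOn (AggregateLearning.eventLoss (fun i => X i ω) (y ω) (B ω))
            Set.univ (θhat ω)) →
          ∀ᵐ ω ∂P, ω ∈ E →
            P⁻[fun ω' => ENNReal.ofReal (‖θhat ω' - θ‖ ^ 2) | 𝒢] ω ≤ ENNReal.ofReal
              ((8 * k * κ ^ 2 * ‖θ‖ ^ 2 * Real.log n
                  + σ ^ 2 * min (AggregateLearning.numBags (B ω) : ℝ) d)
                / (n * AggregateLearning.sigmaMin M - C * √((d : ℝ) * n)))) ∧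
        -- the bound for the estimator that uses the bags of an approximate prior
        (∀ (ytilde : Ω → Fin n → ℝ) (Btilde : Ω → AggregateLearning.Bagging n) (ε : ℝ)
          (θhat : Ω → EuclideanSpace ℝ (Fin d)), Measurable θhat →
          (∀ b, MeasurableSet[𝒢] {ω | Btilde ω = b}) →
          (∀ᵐ ω ∂P, AggregateLearning.IsOptimalBagging k (ytilde ω) (Btilde ω)) →
          (∀ᵐ ω ∂P, AggregateLearning.opNorm
            ((AggregateLearning.bagMatrix (B ω)).transpose * AggregateLearning.bagMatrix (B ω)
              - (AggregateLearning.bagMatrix (Btilde ω)).transpose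
                * AggregateLearning.bagMatrix (Btilde ω)) ≤ ε) →
          (∀ᵐ ω ∂P, IsMinOn (AggregateLearning.eventLoss (fun i => X i ω) (y ω) (Btilde ω))
            Set.univ (θhat ω)) →
          ∀ η > (0 : ℝ), ∀ᵐ ω ∂P, ω ∈ E →
            P⁻[fun ω' => ENNReal.ofReal (‖θhat ω' - θ‖ ^ 2) | 𝒢] ω ≤ ENNReal.ofReal
              (((1 + 1 / η) * (8 * k * κ ^ 2 * ‖θ‖ ^ 2 * Real.log n)
                  + σ ^ 2 * min (AggregateLearning.numBags (Btilde ω) : ℝ) d)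
                / (n * AggregateLearning.sigmaMin M - C * √((d : ℝ) * n))
                + (1 + η) * (ε ^ 2 * ‖θ‖ ^ 2
                  * ((AggregateLearning.sigmaMax M + C * √((d : ℝ) / n))
                    / (AggregateLearning.sigmaMin M - C * √((d : ℝ) / n))))))  := by
  open AggregateLearning in
  refine ⟨128 * κ ^ 2, by positivity, 1, one_pos, ?_⟩
  intro Ω 𝒢 mΩ P _ n d k hk hkn X M hX hind _ hsub hM hσ θ σ ξ y hξ hξ2 hξ0 hcov hy h𝒢 hX𝒢 hindξ
  set C := 128 * κ ^ 2 with hC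
  set R := κ * ‖θ‖ * (2 * √(Real.log n)) with hR
  have hn : 1 ≤ n := hk.trans hkn
  have hn0 : (0 : ℝ) < n := by exact_mod_cast hn
  -- for `d = 0` there are no singular values and `sigmaMin M = 0`
  have hd : 1 ≤ d := by
    by_contra! h
    obtain rfl : d = 0 := by omega
    rw [sigmaMin, LinearMap.singularValues_of_finrank_le _ (by simp)] at hσ
    simp at hσ
  have hpsd := (hsub ⟨0, hn⟩).posSemidef_secondMoment hκ (hX _) (hM _)
  -- `C √(d / n) < σ_min ≤ κ²` puts the deviation in the subgaussian range of Bernstein's inequality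
  have hdn : √((d : ℝ) / n) ≤ 1 / 2 := by
    have h1 := hσ.trans_le ((hsub ⟨0, hn⟩).sigmaMin_le hκ (hX _) (hM _) hd)
    have h2 : 0 < κ ^ 2 := by positivity
    have h3 : κ ^ 2 * (128 * √((d : ℝ) / n)) < κ ^ 2 * 1 := by rw [hC] at h1; linarith
    linarith [lt_of_mul_lt_mul_left h3 h2.le]
  let T : Set (Fin n → EuclideanSpace ℝ (Fin d)) :=
    {x | (∀ i, |inner ℝ (x i) θ| ≤ R) ∧ ‖gramDeviation M x‖ ≤ C * √((d : ℝ) / n)}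
  have hT : MeasurableSet T := by
    refine MeasurableSet.inter ?_ (measurableSet_le (measurable_norm_gramDeviation M)
      measurable_const)
    change MeasurableSet {x : Fin n → EuclideanSpace ℝ (Fin d) | ∀ i, |inner ℝ (x i) θ| ≤ R}
    rw [Set.ofPred_forall]
    exact MeasurableSet.iInter fun i => measurableSet_le (by fun_prop) measurable_const
  set E : Set Ω := (fun ω i => X i ω) ⁻¹' T with hE_def
  have hE𝒢 : MeasurableSet[𝒢] E := (@measurable_pi_lambda Ω (Fin n) _ 𝒢 _ _ hX𝒢) hT
  have hPE : 1 - 1 / (n : ℝ) - 2 * Real.exp (-(1 * d)) ≤ P.real E := by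
    have h1 : Eᶜ ⊆ {ω | ∃ i, R < |inner ℝ (X i ω) θ|}
        ∪ {ω | C * √((d : ℝ) / n) < ‖gramDeviation M fun i => X i ω‖} := by
      intro ω hω
      by_contra h
      simp only [Set.mem_union, Set.mem_ofPred_eq, not_or, not_exists, not_lt] at h
      exact hω h
    have h2 : P.real Eᶜ ≤ 1 / n + 2 * Real.exp (-d) :=
      (measureReal_mono h1).trans ((measureReal_union_le _ _).trans (add_le_add
        (measure_exists_lt_abs_inner_le hκ hn hX hsub θ)
        (measure_lt_norm_gramDeviation_le hκ hn hX hind hsub hM hdn)))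
    rw [probReal_compl_eq_one_sub (h𝒢 _ hE𝒢)] at h2
    rw [one_mul]; linarith
  set τ := C * √((d : ℝ) / n) with hτ
  -- the denominator of the bound is the lower bound on the Gram matrix on `E`
  have hlam : n * sigmaMin M - C * √((d : ℝ) * n) = n * (sigmaMin M - τ) := by
    have : √((d : ℝ) * n) = n * √((d : ℝ) / n) := by
      rw [← Real.sqrt_sq hn0.le, ← Real.sqrt_mul (by positivity), Real.sqrt_sq hn0.le]
      congr 1
      field_simp
    rw [this, hτ]; ring
  have hgap : 0 < sigmaMin M - τ := sub_pos.2 hσ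
  have hlam0 : 0 < n * (sigmaMin M - τ) := mul_pos hn0 hgap
  have hgram : ∀ ω ∈ E, ∀ v, n * (sigmaMin M - τ) * ‖v‖ ^ 2
      ≤ ∑ i, linPred (fun i => X i ω) v i ^ 2 := fun ω hω v =>
    mul_norm_sq_le_sum_linPred_sq hn hpsd hω.2 v
  have hcost : ∀ ω ∈ E, ∀ B : Bagging n,
      IsOptimalBagging k (linPred (fun i => X i ω) θ) B →
      kMeansCost (linPred (fun i => X i ω) θ) B ≤ 8 * k * κ ^ 2 * ‖θ‖ ^ 2 * Real.log n := by
    intro ω hω B hB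
    refine (hB.kMeansCost_le hk hkn hω.1).trans (le_of_eq ?_)
    rw [hR, mul_pow, mul_pow 2, Real.sq_sqrt (Real.log_nonneg (by exact_mod_cast hn))]
    ring
  refine ⟨E, ⟨T, hT, rfl⟩, hPE, fun B hB => ⟨fun θhat _ hB𝒢 hmin => ?_,
    fun ytilde B' ε θhat _ hB𝒢 _ hε hmin η hη => ?_⟩⟩
  · rw [hlam]
    filter_upwards [hB, condLExp_sq_norm_sub_le hn hξ hξ2 hξ0 hcov hy h𝒢 hX𝒢 hindξ hE𝒢 hlam0 hgram
      hB𝒢 hmin] with ω hBω h hω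
    refine (h hω).trans (ENNReal.ofReal_le_ofReal ?_)
    gcongr
    exact hcost ω hω _ hBω
  · rw [hlam]
    filter_upwards [hB, hε, condLExp_sq_norm_sub_le hn hξ hξ2 hξ0 hcov hy h𝒢 hX𝒢 hindξ hE𝒢 hlam0
      hgram hB𝒢 hmin] with ω hBω hεω h hω
    refine (h hω).trans (ENNReal.ofReal_le_ofReal ?_)
    have h1 := kMeansCost_le_of_opNorm_le hη hεω (linPred (fun i => X i ω) θ)
    have h2 := sum_linPred_sq_le hn M hω.2 θ
    have h3 : kMeansCost (linPred (fun i => X i ω) θ) (B' ω)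
        ≤ (1 + 1 / η) * (8 * k * κ ^ 2 * ‖θ‖ ^ 2 * Real.log n)
          + (1 + η) * (ε ^ 2 * (n * (sigmaMax M + τ) * ‖θ‖ ^ 2)) := by
      refine h1.trans ?_
      gcongr
      exact hcost ω hω _ hBω
    calc _ ≤ ((1 + 1 / η) * (8 * k * κ ^ 2 * ‖θ‖ ^ 2 * Real.log n)
          + (1 + η) * (ε ^ 2 * (n * (sigmaMax M + τ) * ‖θ‖ ^ 2))
          + σ ^ 2 * min (numBags (B' ω) : ℝ) d) / (n * (sigmaMin M - τ)) := by gcongr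
      _ = _ := by field_simp; ring
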